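/- A penny graph is a finite graph drawn in the Euclidean plane, with distinct points as vertices and straight line segments as edges, such that the drawing is plane (edges meet only in common endpoints and contain no further vertex), every edge has length $1$, and any two distinct vertices are at distance at least $1$. Its vertices are in general position if no three of them are collinear. Theorem. Every penny graph on $n$ vertices in general position has at most $43n/18$ edges; moreover, $43n/18 < 2.3889\,n$ for $n \ge 1$. -/

import Mathlib

/-- The Euclidean plane. -/
abbrev Plane : Type := EuclideanSpace ℝ (Fin 2)

/-- The graph `G`, with its vertices placed at the points `p v` of the plane and its edges drawn as
straight line segments, is a matchstick graph: this is a plane drawing (distinct vertices are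
distinct points, no edge passes through a further vertex, and distinct edges meet at most in a
common endpoint), and all edges have unit length. -/
structure IsMatchstickGraph {V : Type*} (G : SimpleGraph V) (p : V → Plane) : Prop where
  injective : Function.Injective p
  dist_eq_one : ∀ u v, G.Adj u v → dist (p u) (p v) = 1
  vertex_notMem : ∀ u v w, G.Adj u v → p w ∈ segment ℝ (p u) (p v) → w = u ∨ w = v
  noncrossing : ∀ a b c d, G.Adj a b → G.Adj c d → s(a, b) ≠ s(c, d) →
    ∀ x, x ∈ segment ℝ (p a) (p b) → x ∈ segment ℝ (p c) (p d) →
      ∃ v, (v = a ∨ v = b) ∧ (v = c ∨ v = d) ∧ x = p v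

/-- A penny graph: a matchstick graph in which any two vertices are at distance at least `1`. -/
structure IsPennyGraph {V : Type*} (G : SimpleGraph V) (p : V → Plane) : Prop
    extends IsMatchstickGraph G p where
  one_le_dist : ∀ u v, u ≠ v → 1 ≤ dist (p u) (p v)

/-- The points `p v` are in general position: no three of them are collinear. -/
def InGeneralPosition {V : Type*} (p : V → Plane) : Prop :=
  ∀ u v w, u ≠ v → u ≠ w → v ≠ w → ¬ Collinear ℝ {p u, p v, p w}

/-- For points with pairwise distances at least `1`, the drawing is automatically plane. So any
graph whose edges are pairs at distance exactly `1` is a penny graph; in particular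
this holds for the graph of all such pairs. -/
theorem isPennyGraph_of_dist {V : Type*} (G : SimpleGraph V) (p : V → Plane)
    (hsep : ∀ u v, u ≠ v → 1 ≤ dist (p u) (p v))
    (hunit : ∀ u v, G.Adj u v → dist (p u) (p v) = 1) : IsPennyGraph G p := by
  have key : ∀ u v x, x ∈ segment ℝ (p u) (p v) → dist (p u) x + dist x (p v) = dist (p u) (p v) :=
    fun u v x hx => dist_add_dist_of_mem_segment hx
  have hinj : Function.Injective p := by
    intro u v h
    by_contra hne
    have := hsep u v hne
    rw [h, dist_self] at this
    linarith
  -- Two distinct edges at a common endpoint meet only there.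
  have share : ∀ a b c, G.Adj a b → G.Adj a c → b ≠ c → ∀ x, x ∈ segment ℝ (p a) (p b) →
      x ∈ segment ℝ (p a) (p c) → x = p a := by
    intro a b c hab hac hbc x hxb hxc
    have h1 := key a b x hxb
    have h2 := key a c x hxc
    rw [hunit a b hab] at h1
    rw [hunit a c hac] at h2
    rw [segment_eq_image_lineMap] at hxb hxc
    obtain ⟨s, hs, rfl⟩ := hxb
    obtain ⟨t, ht, hts⟩ := hxc
    have e1 : dist (p a) (AffineMap.lineMap (p a) (p b) s) = s := by
      rw [dist_left_lineMap, hunit a b hab, Real.norm_of_nonneg hs.1, mul_one]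
    have e2 : dist (p a) (AffineMap.lineMap (p a) (p c) t) = t := by
      rw [dist_left_lineMap, hunit a c hac, Real.norm_of_nonneg ht.1, mul_one]
    have est : s = t := by rw [← e1, ← hts, e2]
    subst est
    by_cases h0 : s = 0
    · simp [h0]
    · exfalso
      apply hbc
      apply hinj
      rw [AffineMap.lineMap_apply_module, AffineMap.lineMap_apply_module] at hts
      exact (smul_right_injective Plane h0 (add_left_cancel hts)).symm
  refine { injective := hinj, dist_eq_one := hunit, vertex_notMem := ?_, noncrossing := ?_,
           one_le_dist := hsep }
  · intro u v w huv hw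
    by_contra! hne
    have h := key u v (p w) hw
    rw [hunit u v huv] at h
    have h1 := hsep u w hne.1.symm
    have h2 := hsep w v hne.2
    linarith
  · intro a b c d hab hcd hne x hx hy
    by_cases hac : a = c
    · subst hac
      have hbd : b ≠ d := by rintro rfl; exact hne rfl
      exact ⟨a, Or.inl rfl, Or.inl rfl, share a b d hab hcd hbd x hx hy⟩
    by_cases had : a = d
    · subst had
      have hbc : b ≠ c := by rintro rfl; exact hne Sym2.eq_swap
      exact ⟨a, Or.inl rfl, Or.inr rfl,
        share a b c hab hcd.symm hbc x hx (by rwa [segment_symm])⟩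
    by_cases hbc : b = c
    · subst hbc
      exact ⟨b, Or.inr rfl, Or.inl rfl,
        share b a d hab.symm hcd had x (by rwa [segment_symm]) hy⟩
    by_cases hbd : b = d
    · subst hbd
      exact ⟨b, Or.inr rfl, Or.inr rfl,
        share b a c hab.symm hcd.symm hac x (by rwa [segment_symm]) (by rwa [segment_symm])⟩
    exfalso
    have h1 := key a b x hx
    have h2 := key c d x hy
    rw [hunit a b hab] at h1
    rw [hunit c d hcd] at h2
    have tac := dist_triangle (p a) x (p c)
    have tad := dist_triangle (p a) x (p d)
    have tbc := dist_triangle (p b) x (p c)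
    have tbd := dist_triangle (p b) x (p d)
    have sac := hsep a c hac
    have sad := hsep a d had
    have sbc := hsep b c hbc
    have sbd := hsep b d hbd
    rw [dist_comm (p b) x] at tbc tbd
    rw [dist_comm x (p c)] at tac tbc
    have c1 : dist (p a) x = 1 / 2 := by linarith
    have c2 : dist x (p b) = 1 / 2 := by linarith
    have c3 : dist (p c) x = 1 / 2 := by linarith
    have c4 : dist x (p d) = 1 / 2 := by linarith
    have m1 : x = midpoint ℝ (p a) (p c) :=
      eq_midpoint_of_dist_eq_half (by linarith) (by rw [dist_comm]; linarith)
    have m2 : x = midpoint ℝ (p a) (p d) :=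
      eq_midpoint_of_dist_eq_half (by linarith) (by linarith)
    have hcd' : p c = p d := by
      rw [m1, midpoint_eq_smul_add, midpoint_eq_smul_add] at m2
      exact add_left_cancel (smul_right_injective Plane (by norm_num : (⅟2 : ℝ) ≠ 0) m2)
    exact hcd.ne (hinj hcd')

/-!
Place the points in the complex plane and join all pairs at distance `1`; the given graph is a
subgraph of the resulting one. General position is used only through the fact that no point is the
midpoint of two others. The neighbours of a vertex `u` are ordered counterclockwise, and the excess
of a corner of `u` is the amount by which its angle exceeds `π/3`, in units of `π/3`. Excesses are
nonnegative, and they add up to `1` at a vertex of degree five and to `2` at a vertex of degree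
four. A corner has excess `0` if and only if it is the corner of a triangle. Everything rests on
three local facts.

* There are no three consecutive triangles at a vertex, because two of its neighbours would be
  opposite (`not_three_triangles`). In particular all degrees are at most five, and a vertex of
  degree five lies in at most three triangles; it is called full if it lies in three.
* The two corners on a side of an edge without a triangle have excesses with sum at least `1`
  (`side`), with equality only for a rhombus (`rhombus_of_ex_add`).
* A corner that belongs neither to a triangle nor to a rhombus has large excess together with the
  two corners next to it (`rhombus_or_gap`).

By the second fact, an edge outside all triangles has an end of degree at most four
(`NN.card_lt`), and if the vertices of an isolated triangle, or of two adjacent triangles, have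
degree five, then there is equality everywhere: the vertices are full and the triangles are
surrounded by rhombi (`Tri.isolated`, `Tri.diamond`). A full vertex between two rhombi cannot have
too many full neighbours, for otherwise it is a midpoint (`FullAt.not_full_a_d`,
`FullAt.not_full_c_e`). Hence a full vertex all of whose neighbours have degree five determines a
nearby vertex of degree at most four (`FullAt.special`).

Now let the vertices of degree at most four give charges to those of degree five, so that each of
the latter receives at least `1` (`one_le_sum_pay`). A vertex `w` of degree `k ≤ 4` gives at most
`9 / 2 * (5 - k) - 1` (`sum_pay_le`). This is trivial for `k ≤ 3`. For `k = 4` it could fail only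
if every neighbour of `w` demanded a full unit. Such a tight vertex is excluded by going through the
arrangements of triangles around it (`not_tight`). Summing up, the number of vertices is at most
`9 / 2` times the sum of all `5 - deg v`, which says that the degrees are at most `43 / 9` on
average (`sum_card_nbrs_le`).
-/


namespace PennyGraph

open Complex Finset

/-! ### Counterclockwise angles -/

/-- The counterclockwise angle from the direction `a` to the direction `b`, normalised to lie in
`(0, 2π]`; it is `2π`, not `0`, when the directions agree. -/
noncomputable def ccw (a b : ℂ) : ℝ := toIocMod Real.two_pi_pos 0 (arg (b / a))

lemma ccw_pos (a b : ℂ) : 0 < ccw a b := (toIocMod_mem_Ioc Real.two_pi_pos 0 _).1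

lemma ccw_le (a b : ℂ) : ccw a b ≤ 2 * Real.pi := by
  have h := (toIocMod_mem_Ioc Real.two_pi_pos 0 (arg (b / a))).2
  rwa [zero_add] at h

lemma mul_exp_ccw {a b : ℂ} (ha : ‖a‖ = 1) (hb : ‖b‖ = 1) : a * exp (ccw a b * I) = b := by
  have ha0 : a ≠ 0 := by rintro rfl; simp at ha
  have h1 : ccw a b = arg (b / a) - toIocDiv Real.two_pi_pos 0 (arg (b / a)) * (2 * Real.pi) := by
    rw [ccw, toIocMod, zsmul_eq_mul]
  have h2 : exp (ccw a b * I) = exp (arg (b / a) * I) := by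
    rw [exp_eq_exp_iff_exists_int]
    refine ⟨-toIocDiv Real.two_pi_pos 0 (arg (b / a)), ?_⟩
    rw [h1]; push_cast; ring
  have h3 := norm_mul_exp_arg_mul_I (b / a)
  rw [norm_div, ha, hb] at h3
  rw [h2]
  simp only [div_one, ofReal_one, one_mul] at h3
  rw [h3]; field_simp

lemma ccw_eq_of_mul_exp {a b : ℂ} (ha : ‖a‖ = 1) (hb : ‖b‖ = 1) {θ : ℝ} (h0 : 0 < θ)
    (h1 : θ ≤ 2 * Real.pi) (h : b = a * exp (θ * I)) : ccw a b = θ := by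
  have ha0 : a ≠ 0 := by rintro rfl; simp at ha
  have h2 : exp (ccw a b * I) = exp (θ * I) := by
    apply mul_left_cancel₀ ha0
    rw [mul_exp_ccw ha hb, h]
  rw [exp_eq_exp_iff_exists_int] at h2
  obtain ⟨k, hk⟩ := h2
  have h3 : ccw a b = θ + k * (2 * Real.pi) := by
    have := congrArg im hk
    simpa using this
  have p1 := ccw_pos a b
  have p2 := ccw_le a b
  have pp := Real.pi_pos
  have k0 : k = 0 := by
    have u1 : (k : ℝ) < 1 := by
      by_contra hc
      push Not at hc
      nlinarith
    have u2 : (-1 : ℝ) < k := by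
      by_contra hc
      push Not at hc
      nlinarith
    have u3 : k < 1 := by exact_mod_cast u1
    have u4 : -1 < k := by exact_mod_cast u2
    omega
  simpa [k0] using h3

lemma norm_exp_sub_one_sq (θ : ℝ) : ‖exp (θ * I) - 1‖ ^ 2 = 2 - 2 * Real.cos θ := by
  rw [← normSq_eq_norm_sq, normSq_apply, exp_mul_I, ← ofReal_cos, ← ofReal_sin]
  simp only [sub_re, add_re, ofReal_re, mul_re, I_re, mul_zero, ofReal_im, I_im, mul_one, sub_self,
    add_zero, one_re, sub_im, add_im, mul_im, one_im, sub_zero, zero_add]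
  nlinarith [Real.sin_sq_add_cos_sq θ]

/-! ### Configurations and the cyclic order of neighbours -/

/-- Points of the complex plane at mutual distances at least `1`, none of which is
the midpoint of two others. -/
structure Config (V : Type*) where
  /-- the position of a point -/
  z : V → ℂ
  one_le_norm_sub : ∀ u v, u ≠ v → 1 ≤ ‖z u - z v‖
  add_ne_two_mul : ∀ u v w, u ≠ w → z u + z w ≠ 2 * z v

namespace Config

variable {V : Type*} (C : Config V)

/-- The vector from `u` to `v`. -/
def vec (u v : V) : ℂ := C.z v - C.z u

variable {C} {u v w : V}

lemma z_injective : Function.Injective C.z := by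
  intro u v h
  by_contra hne
  have := C.one_le_norm_sub u v hne
  rw [h] at this
  norm_num at this

lemma eq_of_vec_eq (h : C.vec u v = C.vec u w) : v = w := by
  apply C.z_injective
  simpa [vec] using h

lemma eq_of_norm_lt_one (h : ‖C.z u - C.z v‖ < 1) : u = v := by
  by_contra hne
  linarith [C.one_le_norm_sub u v hne]

lemma vec_rev (u v : V) : C.vec u v = -C.vec v u := by simp [vec]

lemma vec_add (u v w : V) : C.vec u v + C.vec v w = C.vec u w := by simp only [vec]; ring

variable [Fintype V]

variable (C) in
open Classical in
/-- The neighbours of `u` in the graph of all pairs at distance `1`. -/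
noncomputable def nbrs (u : V) : Finset V := univ.filter fun v => ‖C.vec u v‖ = 1

lemma mem_nbrs : v ∈ C.nbrs u ↔ ‖C.vec u v‖ = 1 := by simp [nbrs]

lemma mem_nbrs_comm : v ∈ C.nbrs u ↔ u ∈ C.nbrs v := by
  rw [mem_nbrs, mem_nbrs, vec, vec, norm_sub_rev]

lemma pi_div_three_le_ccw (hv : v ∈ C.nbrs u) (hw : w ∈ C.nbrs u) :
    Real.pi / 3 ≤ ccw (C.vec u v) (C.vec u w) := by
  have pp := Real.pi_pos
  by_cases hvw : v = w
  · subst hvw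
    rw [ccw_eq_of_mul_exp (mem_nbrs.1 hv) (mem_nbrs.1 hv) Real.two_pi_pos le_rfl (by simp)]
    linarith
  have h1 : 1 ≤ ‖C.vec u w - C.vec u v‖ := by
    simpa [vec] using C.one_le_norm_sub w v (Ne.symm hvw)
  have h2 := mul_exp_ccw (mem_nbrs.1 hv) (mem_nbrs.1 hw)
  set θ := ccw (C.vec u v) (C.vec u w) with hθ
  have h3 : C.vec u w - C.vec u v = C.vec u v * (exp (θ * I) - 1) := by rw [← h2]; ring
  rw [h3, norm_mul, mem_nbrs.1 hv, one_mul] at h1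
  by_contra hc
  push Not at hc
  have h4 : Real.cos (Real.pi / 3) < Real.cos θ :=
    Real.cos_lt_cos_of_nonneg_of_le_pi (ccw_pos _ _).le (by linarith) hc
  rw [Real.cos_pi_div_three] at h4
  have h5 := norm_exp_sub_one_sq θ
  nlinarith

variable (C) in
open Classical in
/-- The neighbour of `u` that follows the neighbour `v` in counterclockwise order around `u`. -/
noncomputable def next (u v : V) : V :=
  if h : ∃ w ∈ C.nbrs u, ∀ x ∈ C.nbrs u,
      ccw (C.vec u v) (C.vec u w) ≤ ccw (C.vec u v) (C.vec u x) then h.choose else v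

variable (C) in
/-- The angle at `u` of the corner between the neighbour `v` and the next one. -/
noncomputable def ang (u v : V) : ℝ := ccw (C.vec u v) (C.vec u (C.next u v))

lemma next_spec (hv : v ∈ C.nbrs u) : C.next u v ∈ C.nbrs u ∧ ∀ x ∈ C.nbrs u,
    C.ang u v ≤ ccw (C.vec u v) (C.vec u x) := by
  have h : ∃ w ∈ C.nbrs u, ∀ x ∈ C.nbrs u,
      ccw (C.vec u v) (C.vec u w) ≤ ccw (C.vec u v) (C.vec u x) :=
    Finset.exists_min_image _ _ ⟨v, hv⟩
  rw [ang, next, dif_pos h]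
  exact h.choose_spec

lemma next_mem (hv : v ∈ C.nbrs u) : C.next u v ∈ C.nbrs u := (next_spec hv).1

lemma ang_pos (u v : V) : 0 < C.ang u v := ccw_pos _ _

lemma pi_div_three_le_ang (hv : v ∈ C.nbrs u) : Real.pi / 3 ≤ C.ang u v :=
  pi_div_three_le_ccw hv (next_mem hv)

lemma vec_next (hv : v ∈ C.nbrs u) : C.vec u (C.next u v) = C.vec u v * exp (C.ang u v * I) :=
  (mul_exp_ccw (mem_nbrs.1 hv) (mem_nbrs.1 (next_mem hv))).symm

/-- Two neighbours at an angle of less than `2π/3` are consecutive, since a third one does not fit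
between them. -/
lemma next_eq (ha : v ∈ C.nbrs u) (hb : w ∈ C.nbrs u) {θ : ℝ} (h0 : 0 < θ)
    (h1 : θ < 2 * Real.pi / 3) (h : C.vec u w = C.vec u v * exp (θ * I)) :
    C.next u v = w ∧ C.ang u v = θ := by
  have pp := Real.pi_pos
  have e1 := ccw_eq_of_mul_exp (mem_nbrs.1 ha) (mem_nbrs.1 hb) h0 (by linarith) h
  have e2 : C.ang u v ≤ θ := e1 ▸ (next_spec ha).2 w hb
  rcases e2.lt_or_eq with e3 | e3
  · have e4 := pi_div_three_le_ccw (next_mem ha) hb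
    rw [ccw_eq_of_mul_exp (θ := θ - C.ang u v) (mem_nbrs.1 (next_mem ha)) (mem_nbrs.1 hb)
      (by linarith) (by linarith [ang_pos (C := C) u v])] at e4
    · linarith [pi_div_three_le_ang ha]
    · rw [vec_next ha, h, mul_assoc, ← exp_add]
      congr 2; push_cast; ring
  · refine ⟨?_, e3⟩
    apply eq_of_vec_eq (C := C) (u := u)
    rw [vec_next ha, e3, h]

lemma iterate_next_mem (hv : v ∈ C.nbrs u) (i : ℕ) : (C.next u)^[i] v ∈ C.nbrs u := by
  induction i with
  | zero => exact hv
  | succ i ih => rw [Function.iterate_succ_apply']; exact next_mem ih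

open Classical in
/-- Stepping through the neighbours of `u` in counterclockwise order runs through each of them
exactly once before returning to the start, and turns by `2π` in total. -/
lemma iterate_next (hv : v ∈ C.nbrs u) :
    (C.next u)^[#(C.nbrs u)] v = v ∧
    ∑ i ∈ range #(C.nbrs u), C.ang u ((C.next u)^[i] v) = 2 * Real.pi ∧
    Set.InjOn (fun i => (C.next u)^[i] v) (range #(C.nbrs u)) ∧
    (range #(C.nbrs u)).image (fun i => (C.next u)^[i] v) = C.nbrs u := by
  have pp := Real.pi_pos
  set x : ℕ → V := fun i => (C.next u)^[i] v with hx
  set S : ℕ → ℝ := fun i => ∑ j ∈ range i, C.ang u (x j) with hS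
  have xm : ∀ i, x i ∈ C.nbrs u := iterate_next_mem hv
  have xs : ∀ i, x (i + 1) = C.next u (x i) := fun i => Function.iterate_succ_apply' _ _ _
  have Ss : ∀ i, S (i + 1) = S i + C.ang u (x i) := fun i => sum_range_succ _ _
  have S0 : S 0 = 0 := by simp [hS]
  have Sge : ∀ i : ℕ, i * (Real.pi / 3) ≤ S i := by
    intro i
    induction i with
    | zero => simp [S0]
    | succ i ih => rw [Ss]; push_cast; linarith [pi_div_three_le_ang (xm i)]
  have Smono : StrictMono S := strictMono_nat_of_lt_succ fun i => by
    rw [Ss]; linarith [ang_pos (C := C) u (x i)]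
  have Svec : ∀ i, C.vec u (x i) = C.vec u v * exp (S i * I) := by
    intro i
    induction i with
    | zero => simp [S0, hx]
    | succ i ih =>
      rw [xs, vec_next (xm i), ih, Ss, mul_assoc, ← exp_add]
      congr 2; push_cast; ring
  have step : ∀ i, S i < 2 * Real.pi → S (i + 1) ≤ 2 * Real.pi := by
    intro i hi
    have h1 := (next_spec (xm i)).2 v hv
    have hSi : 0 ≤ S i := S0 ▸ Smono.monotone (Nat.zero_le i)
    rw [ccw_eq_of_mul_exp (θ := 2 * Real.pi - S i) (mem_nbrs.1 (xm i)) (mem_nbrs.1 hv)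
      (by linarith) (by linarith)] at h1
    · rw [Ss]; linarith
    · rw [Svec, mul_assoc, ← exp_add]
      have : (S i : ℂ) * I + ((2 * Real.pi - S i : ℝ) : ℂ) * I = 2 * Real.pi * I := by
        push_cast; ring
      rw [this, exp_two_pi_mul_I, mul_one]
  have hex : ∃ i, 2 * Real.pi ≤ S i := ⟨6, by have := Sge 6; norm_num at this; linarith⟩
  obtain ⟨k, hk, hkmin⟩ : ∃ k, 2 * Real.pi ≤ S (k + 1) ∧ ∀ i ≤ k, S i < 2 * Real.pi := by
    have hn0 : Nat.find hex ≠ 0 := by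
      intro h0
      have := Nat.find_spec hex
      rw [h0, S0] at this; linarith
    obtain ⟨k, hk⟩ := Nat.exists_eq_succ_of_ne_zero hn0
    refine ⟨k, ?_, fun i hi => ?_⟩
    · rw [← Nat.succ_eq_add_one, ← hk]; exact Nat.find_spec hex
    · have := Nat.find_min hex (m := i) (by omega)
      linarith
  have hSk : S (k + 1) = 2 * Real.pi := le_antisymm (step k (hkmin k le_rfl)) hk
  have hxk : x (k + 1) = v := by
    apply eq_of_vec_eq (C := C) (u := u)
    rw [Svec, hSk]
    have : ((2 * Real.pi : ℝ) : ℂ) * I = 2 * Real.pi * I := by push_cast; ring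
    rw [this, exp_two_pi_mul_I, mul_one]
  have inj : Set.InjOn x (range (k + 1)) := by
    have key : ∀ i j, i < j → j ≤ k → x i ≠ x j := by
      intro i j hij hj h
      have h1 := Svec i
      rw [h, Svec j] at h1
      have hSi : 0 ≤ S i := S0 ▸ Smono.monotone (Nat.zero_le i)
      have hlt := Smono hij
      have hv0 : C.vec u v ≠ 0 := by
        intro h0
        have := mem_nbrs.1 hv
        rw [h0] at this; simp at this
      have e1 := ccw_eq_of_mul_exp (a := C.vec u v) (b := C.vec u v) (θ := S j - S i)
        (mem_nbrs.1 hv) (mem_nbrs.1 hv) (by linarith) (by linarith [hkmin j hj]) (by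
          have h2 : exp (((S j - S i : ℝ) : ℂ) * I) = 1 := by
            have : ((S j - S i : ℝ) : ℂ) * I = S j * I - S i * I := by push_cast; ring
            rw [this, exp_sub, mul_left_cancel₀ hv0 h1, div_self (exp_ne_zero _)]
          rw [h2, mul_one])
      rw [ccw_eq_of_mul_exp (mem_nbrs.1 hv) (mem_nbrs.1 hv) Real.two_pi_pos le_rfl (by simp)] at e1
      linarith [hkmin j hj]
    intro i hi j hj h
    simp only [coe_range, Set.mem_Iio] at hi hj
    rcases lt_trichotomy i j with hij | hij | hij
    · exact absurd h (key i j hij (by omega))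
    · exact hij
    · exact absurd h.symm (key j i hij (by omega))
  have img : (range (k + 1)).image x = C.nbrs u := by
    apply subset_antisymm
    · intro w hw
      obtain ⟨i, -, rfl⟩ := mem_image.1 hw
      exact xm i
    · intro w hw
      rw [mem_image]
      by_contra hc
      push Not at hc
      set t := ccw (C.vec u v) (C.vec u w) with ht
      have ht0 : 0 < t := ccw_pos _ _
      have hwt : C.vec u w = C.vec u v * exp (t * I) :=
        (mul_exp_ccw (mem_nbrs.1 hv) (mem_nbrs.1 hw)).symm
      -- No partial sum can be the last one below `t`, so all of them are.
      have all : ∀ i ≤ k + 1, S i < t := by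
        intro i
        induction i with
        | zero => intro _; rw [S0]; exact ht0
        | succ i ih =>
          intro hi
          have h1 := ih (by omega)
          have hSi : 0 ≤ S i := S0 ▸ Smono.monotone (Nat.zero_le i)
          have e : C.vec u w = C.vec u (x i) * exp ((t - S i : ℝ) * I) := by
            rw [hwt, Svec, mul_assoc, ← exp_add]
            congr 2; push_cast; ring
          have h2 := (next_spec (xm i)).2 w hw
          rw [ccw_eq_of_mul_exp (θ := t - S i) (mem_nbrs.1 (xm i)) (mem_nbrs.1 hw)
            (by linarith) (by linarith [ccw_le (C.vec u v) (C.vec u w)]) e] at h2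
          rcases h2.lt_or_eq with h3 | h3
          · rw [Ss]; linarith
          · exfalso
            have h4 : x (i + 1) = w := by
              apply eq_of_vec_eq (C := C) (u := u)
              rw [xs, vec_next (xm i), h3, e]
            by_cases hik : i = k
            · subst hik
              exact hc 0 (by simp) (by rw [← h4, hxk]; rfl)
            · exact hc (i + 1) (by rw [mem_range]; omega) h4
      have := all (k + 1) le_rfl
      rw [hSk] at this
      linarith [ccw_le (C.vec u v) (C.vec u w)]
  have hcard : #(C.nbrs u) = k + 1 := by
    rw [← img, card_image_of_injOn inj, card_range]
  rw [hcard]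
  exact ⟨hxk, hSk, inj, img⟩

variable (C) in
/-- The neighbour of `u` that precedes the neighbour `v` in counterclockwise order around `u`. -/
noncomputable def prev (u v : V) : V := (C.next u)^[#(C.nbrs u) - 1] v

lemma prev_mem (hv : v ∈ C.nbrs u) : C.prev u v ∈ C.nbrs u := iterate_next_mem hv _

lemma next_prev (hv : v ∈ C.nbrs u) : C.next u (C.prev u v) = v := by
  have h : 0 < #(C.nbrs u) := card_pos.2 ⟨v, hv⟩
  rw [prev, ← Function.iterate_succ_apply' (C.next u)]
  rw [show (#(C.nbrs u) - 1).succ = #(C.nbrs u) by omega]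
  exact (iterate_next hv).1

lemma prev_next (hv : v ∈ C.nbrs u) : C.prev u (C.next u v) = v := by
  have h : 0 < #(C.nbrs u) := card_pos.2 ⟨v, hv⟩
  rw [prev, ← Function.iterate_succ_apply (C.next u)]
  rw [show (#(C.nbrs u) - 1).succ = #(C.nbrs u) by omega]
  exact (iterate_next hv).1

/-! ### Corners -/

variable (C) in
/-- The excess of the corner at `u` between the neighbour `v` and the next one over the least
possible angle `π/3`, in units of `π/3`. The corner is that of a triangle if and only if its excess
vanishes. -/
noncomputable def ex (u v : V) : ℝ := C.ang u v / (Real.pi / 3) - 1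

lemma ang_eq (u v : V) : C.ang u v = (1 + C.ex u v) * (Real.pi / 3) := by
  have := Real.pi_pos
  rw [ex]; field_simp; ring

lemma ex_nonneg (hv : v ∈ C.nbrs u) : 0 ≤ C.ex u v := by
  have := Real.pi_pos
  have h := pi_div_three_le_ang hv
  rw [ex, sub_nonneg, le_div_iff₀ (by positivity)]
  linarith

/-- The rotation by `π/3`. -/
noncomputable def rot : ℂ := exp ((Real.pi / 3 : ℝ) * I)

lemma norm_rot : ‖rot‖ = 1 := norm_exp_ofReal_mul_I _

lemma rot_sq : rot ^ 2 = rot - 1 := by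
  have h : rot = 1 / 2 + (Real.sqrt 3 / 2 : ℝ) * I := by
    rw [rot, exp_mul_I, ← ofReal_cos, ← ofReal_sin, Real.cos_pi_div_three,
      Real.sin_pi_div_three]
    push_cast; ring
  have h3 : ((Real.sqrt 3 : ℝ) : ℂ) ^ 2 = 3 := by
    rw [← ofReal_pow, Real.sq_sqrt (by norm_num)]; norm_num
  rw [h]; push_cast
  linear_combination ((Real.sqrt 3 : ℝ) : ℂ) ^ 2 / 4 * I_sq - h3 / 4

lemma rot_cube : rot ^ 3 = -1 := by linear_combination (rot + 1) * rot_sq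

lemma vec_ne_zero (hv : v ∈ C.nbrs u) : C.vec u v ≠ 0 := by
  intro h
  have := mem_nbrs.1 hv
  rw [h] at this; simp at this

lemma vec_next_of_ex_eq_zero (hv : v ∈ C.nbrs u) (h : C.ex u v = 0) :
    C.vec u (C.next u v) = C.vec u v * rot := by
  rw [vec_next hv, ang_eq, h, rot]; norm_num

/-- A corner of angle `π/3` belongs to a triangle, whose corners are all of this kind. -/
lemma triangle (hv : v ∈ C.nbrs u) (h : C.ex u v = 0) :
    C.next u v ∈ C.nbrs v ∧ C.next v (C.next u v) = u ∧ C.ex v (C.next u v) = 0 := by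
  have pp := Real.pi_pos
  have h1 := vec_next_of_ex_eq_zero hv h
  set w := C.next u v
  have h2 : C.vec v w = C.vec u v * rot ^ 2 := by
    rw [← vec_add v u w, vec_rev v u, h1, rot_sq]; ring
  have h3 : w ∈ C.nbrs v := by
    rw [mem_nbrs, h2, norm_mul, norm_pow, norm_rot, mem_nbrs.1 hv]; norm_num
  have h4 : C.vec v u = C.vec v w * exp ((Real.pi / 3 : ℝ) * I) := by
    rw [← rot, h2, vec_rev v u, mul_assoc, ← pow_succ, rot_cube]; ring
  obtain ⟨h5, h6⟩ := next_eq h3 (mem_nbrs_comm.1 hv) (by linarith) (by linarith) h4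
  refine ⟨h3, h5, ?_⟩
  rw [ex, h6, div_self (by positivity), sub_self]

/-- Three consecutive triangles at a vertex make two of its neighbours opposite. -/
lemma not_three_triangles (hv : v ∈ C.nbrs u) (h1 : C.ex u v = 0)
    (h2 : C.ex u (C.next u v) = 0) (h3 : C.ex u (C.next u (C.next u v)) = 0) : False := by
  have e1 := vec_next_of_ex_eq_zero hv h1
  have e2 := vec_next_of_ex_eq_zero (next_mem hv) h2
  have e3 := vec_next_of_ex_eq_zero (next_mem (next_mem hv)) h3
  set w := C.next u (C.next u (C.next u v))
  have e4 : C.vec u w = -C.vec u v := by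
    rw [e3, e2, e1]; linear_combination C.vec u v * rot_cube
  have hne : v ≠ w := by
    intro h
    rw [← h] at e4
    apply vec_ne_zero hv
    linear_combination e4 / 2
  apply C.add_ne_two_mul v u w hne
  simp only [vec] at e4
  linear_combination e4

/-! ### Sides -/

/-- The squared distance between the ends of a path of three unit segments with angles `α` and
`β` on the same side. -/
lemma norm_side_sq (α β : ℝ) : ‖1 - exp (-(β * I)) - exp (α * I)‖ ^ 2 =
    3 - 2 * Real.cos α - 2 * Real.cos β + 2 * Real.cos (α + β) := by
  have h1 : exp (α * I) = (Real.cos α : ℂ) + (Real.sin α : ℂ) * I := by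
    rw [exp_mul_I, ofReal_cos, ofReal_sin]
  have h2 : exp (-(β * I)) = (Real.cos β : ℂ) - (Real.sin β : ℂ) * I := by
    rw [← neg_mul, exp_mul_I, Complex.cos_neg, Complex.sin_neg, ofReal_cos, ofReal_sin]; ring
  rw [h1, h2, ← normSq_eq_norm_sq, normSq_apply, Real.cos_add]
  simp only [sub_re, one_re, add_re, ofReal_re, mul_re, I_re, mul_zero, ofReal_im, I_im, mul_one,
    sub_self, add_zero, sub_zero, sub_im, one_im, add_im, mul_im, zero_add, zero_sub,
    sub_neg_eq_add]
  nlinarith [Real.sin_sq_add_cos_sq α, Real.sin_sq_add_cos_sq β]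

lemma vec_prev (hv : v ∈ C.nbrs u) :
    C.vec u (C.prev u v) = C.vec u v * exp (-(C.ang u (C.prev u v) * I)) := by
  have h := vec_next (prev_mem hv)
  rw [next_prev hv] at h
  rw [h, mul_assoc, ← exp_add]; simp

/-- On the side of an edge where there is no triangle, the two angles add up to at least `π`:
otherwise the outer ends of the corners would be too close to each other. -/
lemma side (hv : v ∈ C.nbrs u) (h : C.ex u v ≠ 0) : 1 ≤ C.ex u v + C.ex v (C.prev v u) := by
  have pp := Real.pi_pos
  have hu := mem_nbrs_comm.1 hv
  by_contra hc
  push Not at hc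
  have ea := vec_next hv
  have eb := vec_prev hu
  have α0 := pi_div_three_le_ang hv
  have β0 := pi_div_three_le_ang (prev_mem hu)
  have eα := ang_eq (C := C) u v
  have eβ := ang_eq (C := C) v (C.prev v u)
  set b := C.prev v u
  set a := C.next u v with ha
  set α := C.ang u v
  set β := C.ang v b
  have hαβ : α + β < Real.pi := by nlinarith
  have hlt : ‖1 - exp (-(β * I)) - exp (α * I)‖ ^ 2 < 1 := by
    rw [norm_side_sq]
    have h1 : Real.cos (α + β) = 2 * Real.cos ((α + β) / 2) ^ 2 - 1 := by
      rw [← Real.cos_two_mul]; congr 1; ring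
    have h2 : Real.cos α + Real.cos β =
        2 * Real.cos ((α + β) / 2) * Real.cos ((α - β) / 2) := Real.cos_add_cos α β
    have h3 : 0 < Real.cos ((α + β) / 2) :=
      Real.cos_pos_of_mem_Ioo ⟨by linarith, by linarith⟩
    have h4 : Real.cos ((α + β) / 2) < Real.cos ((α - β) / 2) := by
      rw [← Real.cos_abs ((α - β) / 2)]
      apply Real.cos_lt_cos_of_nonneg_of_le_pi (abs_nonneg _) (by linarith)
      rw [abs_lt]; constructor <;> linarith
    nlinarith
  have hab : b = a := by
    apply eq_of_norm_lt_one (C := C)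
    have : C.z b - C.z a = C.vec u v * (1 - exp (-(β * I)) - exp (α * I)) := by
      have : C.z b - C.z a = C.vec u v + C.vec v b - C.vec u a := by simp only [vec]; ring
      rw [this, eb, ea, vec_rev v u]; ring
    rw [this, norm_mul, mem_nbrs.1 hv, one_mul]
    nlinarith [norm_nonneg (1 - exp (-(β * I)) - exp (α * I))]
  have h5 : ‖C.vec v a‖ = 1 := mem_nbrs.1 (hab ▸ prev_mem hu)
  have h6 : C.vec v a = C.vec u v * (exp (α * I) - 1) := by
    rw [← vec_add v u a, ea, vec_rev v u]; ring
  rw [h6, norm_mul, mem_nbrs.1 hv, one_mul] at h5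
  have h7 := norm_exp_sub_one_sq α
  rw [h5] at h7
  have h8 : α = Real.pi / 3 := by
    apply Real.injOn_cos ⟨by linarith, by linarith⟩ ⟨by linarith, by linarith⟩
    rw [Real.cos_pi_div_three]; linarith
  apply h
  nlinarith

variable (C) in
/-- The corner at `u` between `v` and the next neighbour belongs to a rhombus whose vertices, in
counterclockwise order, are `u`, `v`, `prev v u` and `next u v`. -/
structure Rhombus (u v : V) : Prop where
  mem : v ∈ C.nbrs u
  ex_pos : 0 < C.ex u v
  next_next : C.next (C.next u v) u = C.prev v u
  next_prev_next : C.next (C.prev v u) (C.next u v) = v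
  vec_next : C.vec u (C.next u v) = C.vec v (C.prev v u)
  ex_add : C.ex u v + C.ex v (C.prev v u) = 1
  ex_opposite : C.ex (C.prev v u) (C.next u v) = C.ex u v
  ex_opposite' : C.ex (C.next u v) u = C.ex v (C.prev v u)

/-- Equality in `side` means that the two corners belong to a rhombus. -/
lemma rhombus_of_ex_add (hv : v ∈ C.nbrs u) (h : 0 < C.ex u v)
    (hs : C.ex u v + C.ex v (C.prev v u) = 1) : C.Rhombus u v := by
  have pp := Real.pi_pos
  have hu := mem_nbrs_comm.1 hv
  have hb0 : 0 < C.ex v (C.prev v u) := by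
    refine (ex_nonneg (prev_mem hu)).lt_of_ne fun h0 => ?_
    have t1 := triangle (prev_mem hu) h0.symm
    rw [next_prev hu] at t1
    obtain ⟨m1, n1, x1⟩ := t1
    have t2 := triangle m1 x1
    rw [n1] at t2
    linarith [t2.2.2]
  have ea := vec_next hv
  have eb := vec_prev hu
  have eα := ang_eq (C := C) u v
  have eβ := ang_eq (C := C) v (C.prev v u)
  set b := C.prev v u with hb
  set a := C.next u v with ha
  set α := C.ang u v with hα
  set β := C.ang v b
  have hβ : β = Real.pi - α := by nlinarith
  have vec_eq : C.vec u a = C.vec v b := by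
    have : exp (-(β * I)) = -exp (α * I) := by
      have : -((β : ℂ) * I) = α * I - Real.pi * I := by rw [hβ]; push_cast; ring
      rw [this, exp_sub, exp_pi_mul_I, div_neg, div_one]
    rw [ea, eb, this, vec_rev v u]; ring
  have vec_eq' : C.vec a b = C.vec u v := by
    have h1 := vec_add (C := C) u a b
    have h2 := vec_add (C := C) u v b
    rw [← h1, vec_eq] at h2
    linear_combination -h2
  have hba : b ∈ C.nbrs a := by rw [mem_nbrs, vec_eq', mem_nbrs.1 hv]
  have hua : u ∈ C.nbrs a := mem_nbrs_comm.1 (next_mem hv)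
  have hvb : v ∈ C.nbrs b := mem_nbrs_comm.1 (prev_mem hu)
  have na := next_eq hua hba (θ := Real.pi - α) (by nlinarith) (by nlinarith) (by
    have : (((Real.pi - α : ℝ) : ℂ)) * I = Real.pi * I - α * I := by push_cast; ring
    rw [vec_eq', vec_rev a u, ea, this, exp_sub, exp_pi_mul_I]
    field_simp [exp_ne_zero])
  have nb := next_eq (mem_nbrs_comm.1 hba) hvb (θ := α) (by nlinarith) (by nlinarith) (by
    rw [vec_rev b v, ← vec_eq, ea, vec_rev b a, vec_eq']; ring)
  refine ⟨hv, h, na.1, nb.1, vec_eq, hs, ?_, ?_⟩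
  · rw [ex, nb.2, ex]
  · rw [ex, na.2, ← hβ, ex]

lemma Rhombus.rotate (h : C.Rhombus u v) : C.Rhombus v (C.prev v u) := by
  have hu := mem_nbrs_comm.1 h.mem
  have hb := mem_nbrs_comm.1 (prev_mem hu)
  have m : C.next u v ∈ C.nbrs (C.prev v u) := by
    rw [mem_nbrs_comm, ← h.next_next]
    exact next_mem (mem_nbrs_comm.1 (next_mem h.mem))
  have e : C.prev (C.prev v u) v = C.next u v := by
    have := prev_next m
    rwa [h.next_prev_next] at this
  have hp : 0 < C.ex v (C.prev v u) := by
    refine (ex_nonneg (prev_mem hu)).lt_of_ne fun h0 => ?_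
    have t1 := triangle (prev_mem hu) h0.symm
    rw [next_prev hu] at t1
    have t2 := triangle t1.1 t1.2.2
    rw [t1.2.1] at t2
    linarith [t2.2.2, h.ex_pos]
  refine ⟨prev_mem hu, hp, ?_, ?_, ?_, ?_, ?_, ?_⟩
  · rw [next_prev hu, e]
  · rw [next_prev hu, e, h.next_next]
  · rw [next_prev hu, e, vec_rev v u]
    have h1 := vec_add (C := C) u (C.next u v) (C.prev v u)
    have h2 := vec_add (C := C) u v (C.prev v u)
    rw [h.vec_next, ← h2] at h1
    rw [vec_rev (C.prev v u)]
    linear_combination h1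
  · rw [e, h.ex_opposite, add_comm]; exact h.ex_add
  · rw [next_prev hu, e, h.ex_opposite']
  · rw [next_prev hu, e, h.ex_opposite]

/-- The squared distance between the ends of a path of four unit segments, of which the first and
the last are opposite up to an angle of `2B` and the two others are opposite up to an angle of
`2A`. -/
lemma gap_norm (A B ψ : ℝ) :
    ‖1 + exp ((ψ - A + B : ℝ) * I) - exp ((ψ + A + B : ℝ) * I) - exp ((2 * B : ℝ) * I)‖ ^ 2 =
      4 * (Real.sin B ^ 2 + Real.sin A ^ 2 + 2 * Real.sin A * Real.sin B * Real.cos ψ) := by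
  have h : 1 + exp ((ψ - A + B : ℝ) * I) - exp ((ψ + A + B : ℝ) * I) - exp ((2 * B : ℝ) * I) =
      -2 * I * exp ((B : ℝ) * I) *
        ((Real.sin B : ℂ) + (Real.sin A : ℂ) * exp ((ψ : ℝ) * I)) := by
    have e1 : exp ((ψ - A + B : ℝ) * I) =
        exp ((ψ : ℝ) * I) * exp (-((A : ℝ) * I)) * exp ((B : ℝ) * I) := by
      rw [← exp_add, ← exp_add]; congr 1; push_cast; ring
    have e2 : exp ((ψ + A + B : ℝ) * I) =
        exp ((ψ : ℝ) * I) * exp ((A : ℝ) * I) * exp ((B : ℝ) * I) := by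
      rw [← exp_add, ← exp_add]; congr 1; push_cast; ring
    have e3 : exp ((2 * B : ℝ) * I) = exp ((B : ℝ) * I) * exp ((B : ℝ) * I) := by
      rw [← exp_add]; congr 1; push_cast; ring
    have e4 : exp ((B : ℝ) * I) * exp (-((B : ℝ) * I)) = 1 := by rw [← exp_add]; simp
    have e5 (x : ℝ) : (Real.sin x : ℂ) = (exp (-((x : ℝ) * I)) - exp ((x : ℝ) * I)) * I / 2 := by
      rw [ofReal_sin, Complex.sin, neg_mul]
    rw [e1, e2, e3, e5, e5]
    linear_combination (-1 : ℂ) * e4 +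
      (exp ((B : ℝ) * I) * (exp (-((B : ℝ) * I)) - exp ((B : ℝ) * I)) +
      exp ((B : ℝ) * I) * exp ((ψ : ℝ) * I) *
        (exp (-((A : ℝ) * I)) - exp ((A : ℝ) * I))) * I_sq
  rw [h, norm_mul, norm_mul, norm_exp_ofReal_mul_I, norm_mul, norm_I, mul_one, mul_one, mul_pow,
    ← normSq_eq_norm_sq ((Real.sin B : ℂ) + _), normSq_apply, exp_mul_I, ← ofReal_cos,
    ← ofReal_sin]
  have h2 : ‖(-2 : ℂ)‖ ^ 2 = 4 := by rw [norm_neg]; norm_num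
  rw [h2]
  simp only [add_re, ofReal_re, mul_re, I_re, mul_zero, ofReal_im, I_im, mul_one,
    sub_self, add_zero, sub_zero, add_im, mul_im, zero_add, zero_mul]
  nlinarith [Real.sin_sq_add_cos_sq ψ]

/-- A corner of angle greater than `π/3` either belongs to a rhombus, or is so wide together with
its two neighbouring corners that the ends of these are far enough apart. -/
lemma rhombus_or_gap (hv : v ∈ C.nbrs u) (h : 0 < C.ex u v) :
    C.Rhombus u v ∨ 3 < 2 * C.ex u v + C.ex v (C.prev v u) + C.ex (C.next u v) u := by
  have pp := Real.pi_pos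
  have hu := mem_nbrs_comm.1 hv
  have ha := next_mem hv
  have hua := mem_nbrs_comm.1 ha
  have s1 := side hv h.ne'
  have hau : C.ex (C.next u v) u ≠ 0 := by
    intro h0
    obtain ⟨m1, n1, x1⟩ := triangle hua h0
    have := prev_next m1
    rw [n1, prev_next hv] at this
    rw [← this] at x1
    exact h.ne' x1
  have s2 := side hua hau
  rw [prev_next hv] at s2
  rcases s1.eq_or_lt with s1 | s1
  · exact Or.inl (rhombus_of_ex_add hv h s1.symm)
  rcases s2.eq_or_lt with s2 | s2
  · left
    have := (rhombus_of_ex_add hua ((ex_nonneg hua).lt_of_ne' hau)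
      (by rw [prev_next hv]; exact s2.symm)).rotate
    rwa [prev_next hv] at this
  right
  by_contra hc
  push Not at hc
  have ea := vec_next hv
  have eb := vec_prev hu
  have ec := vec_next hua
  have eα := ang_eq (C := C) u v
  have eβ := ang_eq (C := C) v (C.prev v u)
  have eγ := ang_eq (C := C) (C.next u v) u
  set b := C.prev v u with hb
  set a := C.next u v
  set c := C.next a u
  set α := C.ang u v with hα
  set β := C.ang v b with hβ
  set γ := C.ang a u with hγ
  obtain ⟨A, hA⟩ : ∃ A, A = (α + β - Real.pi) / 2 := ⟨_, rfl⟩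
  obtain ⟨B, hB⟩ : ∃ B, B = (α + γ - Real.pi) / 2 := ⟨_, rfl⟩
  have A0 : 0 < A := by nlinarith
  have B0 : 0 < B := by nlinarith
  have AB : A + B ≤ Real.pi / 6 := by nlinarith
  obtain ⟨ψ, hψ⟩ : ∃ ψ, ψ = α - A - B := ⟨_, rfl⟩
  have ψ1 : A + B < ψ := by nlinarith
  have ψ2 : ψ < Real.pi := by
    have := pi_div_three_le_ang (prev_mem hu)
    linarith
  have key : C.z b - C.z c = C.vec u v * (1 + exp ((ψ - A + B : ℝ) * I) -
      exp ((ψ + A + B : ℝ) * I) - exp ((2 * B : ℝ) * I)) := by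
    have e0 : C.z b - C.z c = C.vec u v + C.vec v b - C.vec u a - C.vec a c := by
      simp only [vec]; ring
    have e1 : (ψ - A + B : ℝ) = Real.pi - β := by linarith
    have e2 : (ψ + A + B : ℝ) = α := by linarith
    have e3 : 2 * B = α + γ - Real.pi := by linarith
    have e4 : (((Real.pi - β : ℝ)) : ℂ) * I = Real.pi * I + -(β * I) := by push_cast; ring
    have e5 : (((α + γ - Real.pi : ℝ)) : ℂ) * I = α * I + γ * I - Real.pi * I := by
      push_cast; ring
    rw [e0, e1, e2, e3, e4, e5, exp_add, exp_sub, exp_add, exp_pi_mul_I, ec, eb, vec_rev a u, ea,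
      vec_rev v u]
    ring
  have hn := gap_norm A B ψ
  set w := 1 + exp ((ψ - A + B : ℝ) * I) - exp ((ψ + A + B : ℝ) * I) - exp ((2 * B : ℝ) * I)
  have sA : 0 < Real.sin A := Real.sin_pos_of_pos_of_lt_pi A0 (by linarith)
  have sB : 0 < Real.sin B := Real.sin_pos_of_pos_of_lt_pi B0 (by linarith)
  have c1 : Real.cos ψ < Real.cos (A + B) :=
    Real.cos_lt_cos_of_nonneg_of_le_pi (by linarith) ψ2.le ψ1
  have c2 : -1 < Real.cos ψ := by
    rw [← Real.cos_pi]
    exact Real.cos_lt_cos_of_nonneg_of_le_pi (by linarith) le_rfl ψ2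
  have id1 : Real.sin B ^ 2 + Real.sin A ^ 2 + 2 * Real.sin A * Real.sin B * Real.cos (A + B) =
      Real.sin (A + B) ^ 2 := by
    rw [Real.sin_add, Real.cos_add]
    linear_combination (-Real.sin B ^ 2) * Real.sin_sq_add_cos_sq A -
      Real.sin A ^ 2 * Real.sin_sq_add_cos_sq B
  have s6 : Real.sin (A + B) ≤ 1 / 2 := by
    rw [← Real.sin_pi_div_six]
    exact Real.sin_le_sin_of_le_of_le_pi_div_two (by linarith) (by linarith) AB
  have s7 : 0 < Real.sin (A + B) := Real.sin_pos_of_pos_of_lt_pi (by linarith) (by linarith)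
  have hpos := mul_pos sA sB
  have w1 : ‖w‖ ^ 2 < 1 := by
    rw [hn]
    nlinarith [mul_lt_mul_of_pos_left c1 hpos]
  have w0 : 0 < ‖w‖ ^ 2 := by
    rw [hn]
    nlinarith [mul_lt_mul_of_pos_left c2 hpos, sq_nonneg (Real.sin A - Real.sin B)]
  have hbc : b = c := by
    apply eq_of_norm_lt_one (C := C)
    rw [key, norm_mul, mem_nbrs.1 hv, one_mul]
    nlinarith [norm_nonneg w]
  rw [hbc, sub_self] at key
  rcases mul_eq_zero.1 key.symm with h0 | h0
  · exact vec_ne_zero hv h0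
  · rw [h0] at w0; simp at w0

variable {a b c d e : V}

/-! ### Triangles and the cyclic order of four or five neighbours -/

variable (C) in
/-- `u`, `v`, `w` are the vertices of a triangle in counterclockwise order. -/
structure Tri (u v w : V) : Prop where
  mem : v ∈ C.nbrs u
  next : C.next u v = w
  ex : C.ex u v = 0

lemma tri_next (hv : v ∈ C.nbrs u) (h : C.ex u v = 0) : C.Tri u v (C.next u v) := ⟨hv, rfl, h⟩

lemma Tri.rotate (h : C.Tri u v w) : C.Tri v w u := by
  obtain ⟨hv, rfl, h⟩ := h
  obtain ⟨h1, h2, h3⟩ := triangle hv h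
  exact ⟨h1, h2, h3⟩

lemma Tri.mem' (h : C.Tri u v w) : w ∈ C.nbrs u := mem_nbrs_comm.1 h.rotate.rotate.mem

lemma Tri.prev (h : C.Tri u v w) : C.prev u w = v := by rw [← h.next, prev_next h.mem]

lemma tri_prev (hv : v ∈ C.nbrs u) (h : C.ex u (C.prev u v) = 0) : C.Tri u (C.prev u v) v :=
  ⟨prev_mem hv, next_prev hv, h⟩

lemma Tri.not_three {x : V} (h1 : C.Tri u a b) (h2 : C.Tri u b c) (h3 : C.Tri u c x) : False := by
  apply not_three_triangles h1.mem h1.ex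
  · rw [h1.next]; exact h2.ex
  · rw [h1.next, h2.next]; exact h3.ex

variable (C) in
/-- `u` has exactly the five neighbours `a`, `b`, `c`, `d`, `e`, in counterclockwise order. -/
structure Cyc5 (u a b c d e : V) : Prop where
  card : #(C.nbrs u) = 5
  mem : a ∈ C.nbrs u
  next_a : C.next u a = b
  next_b : C.next u b = c
  next_c : C.next u c = d
  next_d : C.next u d = e
  next_e : C.next u e = a

lemma exists_cyc5 (h : #(C.nbrs u) = 5) (ha : a ∈ C.nbrs u) : ∃ b c d e, C.Cyc5 u a b c d e := by
  have h1 := (iterate_next ha).1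
  rw [h] at h1
  exact ⟨_, _, _, _, h, ha, rfl, rfl, rfl, rfl, h1⟩

namespace Cyc5

lemma mem_b (h : C.Cyc5 u a b c d e) : b ∈ C.nbrs u := h.next_a ▸ next_mem h.mem

lemma rotate (h : C.Cyc5 u a b c d e) : C.Cyc5 u b c d e a :=
  ⟨h.card, h.mem_b, h.next_b, h.next_c, h.next_d, h.next_e, h.next_a⟩

lemma mem_c (h : C.Cyc5 u a b c d e) : c ∈ C.nbrs u := h.rotate.mem_b

lemma mem_d (h : C.Cyc5 u a b c d e) : d ∈ C.nbrs u := h.rotate.mem_c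

lemma mem_e (h : C.Cyc5 u a b c d e) : e ∈ C.nbrs u := h.rotate.mem_d

lemma prev_a (h : C.Cyc5 u a b c d e) : C.prev u a = e := by rw [← h.next_e, prev_next h.mem_e]

lemma prev_b (h : C.Cyc5 u a b c d e) : C.prev u b = a := h.rotate.prev_a

lemma prev_c (h : C.Cyc5 u a b c d e) : C.prev u c = b := h.rotate.prev_b

lemma prev_d (h : C.Cyc5 u a b c d e) : C.prev u d = c := h.rotate.prev_c

lemma prev_e (h : C.Cyc5 u a b c d e) : C.prev u e = d := h.rotate.prev_d

lemma sum (h : C.Cyc5 u a b c d e) :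
    C.ex u a + C.ex u b + C.ex u c + C.ex u d + C.ex u e = 1 := by
  have pp := Real.pi_pos
  have h1 := (iterate_next h.mem).2.1
  rw [h.card] at h1
  simp only [sum_range_succ, range_zero, sum_empty, zero_add, Function.iterate_succ,
    Function.comp_apply, Function.iterate_zero, id_eq, h.next_a, h.next_b, h.next_c,
    h.next_d, ang_eq] at h1
  nlinarith

lemma nodup (h : C.Cyc5 u a b c d e) : [a, b, c, d, e].Nodup := by
  have h1 := (iterate_next h.mem).2.2.1
  rw [h.card] at h1
  have h2 := List.Nodup.map_on (l := List.range 5) (f := fun i => (C.next u)^[i] a)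
    (fun i hi j hj hij => h1 (by simpa using hi) (by simpa using hj) hij) List.nodup_range
  simpa [List.range_succ, h.next_a, h.next_b, h.next_c, h.next_d] using h2

lemma cases (h : C.Cyc5 u a b c d e) {x : V} (hx : x ∈ C.nbrs u) :
    x = a ∨ x = b ∨ x = c ∨ x = d ∨ x = e := by
  classical
  have h1 := (iterate_next h.mem).2.2.2
  rw [← h1, h.card] at hx
  simpa [Finset.range_add_one, h.next_a, h.next_b, h.next_c, h.next_d, or_comm, or_left_comm,
    or_assoc] using hx

lemma ex_nonneg (h : C.Cyc5 u a b c d e) : 0 ≤ C.ex u a ∧ 0 ≤ C.ex u b ∧ 0 ≤ C.ex u c ∧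
    0 ≤ C.ex u d ∧ 0 ≤ C.ex u e :=
  ⟨Config.ex_nonneg h.mem, Config.ex_nonneg h.mem_b, Config.ex_nonneg h.mem_c,
    Config.ex_nonneg h.mem_d, Config.ex_nonneg h.mem_e⟩

lemma not_three (h : C.Cyc5 u a b c d e) (h1 : C.ex u a = 0) (h2 : C.ex u b = 0)
    (h3 : C.ex u c = 0) : False :=
  Tri.not_three ⟨h.mem, h.next_a, h1⟩ ⟨h.mem_b, h.next_b, h2⟩ ⟨h.mem_c, h.next_c, h3⟩

end Cyc5

variable (C) in
/-- `u` has exactly the four neighbours `a`, `b`, `c`, `d`, in counterclockwise order. -/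
structure Cyc4 (u a b c d : V) : Prop where
  card : #(C.nbrs u) = 4
  mem : a ∈ C.nbrs u
  next_a : C.next u a = b
  next_b : C.next u b = c
  next_c : C.next u c = d
  next_d : C.next u d = a

lemma exists_cyc4 (h : #(C.nbrs u) = 4) (ha : a ∈ C.nbrs u) : ∃ b c d, C.Cyc4 u a b c d := by
  have h1 := (iterate_next ha).1
  rw [h] at h1
  exact ⟨_, _, _, h, ha, rfl, rfl, rfl, h1⟩

namespace Cyc4

lemma mem_b (h : C.Cyc4 u a b c d) : b ∈ C.nbrs u := h.next_a ▸ next_mem h.mem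

lemma rotate (h : C.Cyc4 u a b c d) : C.Cyc4 u b c d a :=
  ⟨h.card, h.mem_b, h.next_b, h.next_c, h.next_d, h.next_a⟩

lemma mem_c (h : C.Cyc4 u a b c d) : c ∈ C.nbrs u := h.rotate.mem_b

lemma mem_d (h : C.Cyc4 u a b c d) : d ∈ C.nbrs u := h.rotate.mem_c

lemma prev_a (h : C.Cyc4 u a b c d) : C.prev u a = d := by rw [← h.next_d, prev_next h.mem_d]

lemma prev_b (h : C.Cyc4 u a b c d) : C.prev u b = a := h.rotate.prev_a

lemma prev_c (h : C.Cyc4 u a b c d) : C.prev u c = b := h.rotate.prev_b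

lemma prev_d (h : C.Cyc4 u a b c d) : C.prev u d = c := h.rotate.prev_c

lemma sum (h : C.Cyc4 u a b c d) : C.ex u a + C.ex u b + C.ex u c + C.ex u d = 2 := by
  have pp := Real.pi_pos
  have h1 := (iterate_next h.mem).2.1
  rw [h.card] at h1
  simp only [sum_range_succ, range_zero, sum_empty, zero_add, Function.iterate_succ,
    Function.comp_apply, Function.iterate_zero, id_eq, h.next_a, h.next_b, h.next_c, ang_eq] at h1
  nlinarith

lemma not_three (h : C.Cyc4 u a b c d) (h1 : C.ex u a = 0) (h2 : C.ex u b = 0)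
    (h3 : C.ex u c = 0) : False :=
  Tri.not_three ⟨h.mem, h.next_a, h1⟩ ⟨h.mem_b, h.next_b, h2⟩ ⟨h.mem_c, h.next_c, h3⟩

end Cyc4

/-- Six corners of angle at least `π/3` would all be corners of triangles, three of them
consecutive. -/
lemma card_nbrs_le (u : V) : #(C.nbrs u) ≤ 5 := by
  have pp := Real.pi_pos
  by_contra hc
  push Not at hc
  obtain ⟨a, ha⟩ : (C.nbrs u).Nonempty := card_pos.1 (by omega)
  have h := (iterate_next ha).2.1
  have hge : ∀ i, 0 ≤ C.ex u ((C.next u)^[i] a) := fun i => ex_nonneg (iterate_next_mem ha i)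
  simp only [ang_eq, ← sum_mul] at h
  have h6 : ∑ i ∈ range #(C.nbrs u), (1 + C.ex u ((C.next u)^[i] a)) = 6 := by nlinarith
  have hsub : ∑ i ∈ range 6, (1 + C.ex u ((C.next u)^[i] a)) ≤ 6 := by
    rw [← h6]
    apply sum_le_sum_of_subset_of_nonneg
    · intro i hi; simp only [mem_range] at hi ⊢; omega
    · intro i _ _; linarith [hge i]
  simp only [sum_range_succ, range_zero, sum_empty] at hsub
  have g0 := hge 0
  have g1 := hge 1
  have g2 := hge 2
  have g3 := hge 3
  have g4 := hge 4
  have g5 := hge 5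
  have z0 : C.ex u ((C.next u)^[0] a) = 0 := by linarith
  have z1 : C.ex u ((C.next u)^[1] a) = 0 := by linarith
  have z2 : C.ex u ((C.next u)^[2] a) = 0 := by linarith
  exact not_three_triangles ha z0 z1 z2

/-! ### Full vertices -/

variable (C) in
/-- A vertex of degree five with three triangles, which are those at the corners starting with `a`,
`b` and `d`. No other arrangement of three triangles is possible. -/
structure FullAt (u a b c d e : V) : Prop extends C.Cyc5 u a b c d e where
  ex_a : C.ex u a = 0
  ex_b : C.ex u b = 0
  ex_d : C.ex u d = 0

variable (C) in
/-- A vertex of degree five with three triangles. -/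
def Full (u : V) : Prop := ∃ a b c d e, C.FullAt u a b c d e

namespace FullAt

lemma tri_ab (h : C.FullAt u a b c d e) : C.Tri u a b := ⟨h.mem, h.next_a, h.ex_a⟩

lemma tri_bc (h : C.FullAt u a b c d e) : C.Tri u b c := ⟨h.mem_b, h.next_b, h.ex_b⟩

lemma tri_de (h : C.FullAt u a b c d e) : C.Tri u d e := ⟨h.mem_d, h.next_d, h.ex_d⟩

lemma ex_c_pos (h : C.FullAt u a b c d e) : 0 < C.ex u c :=
  (ex_nonneg h.mem_c).lt_of_ne' fun h0 => h.not_three h.ex_a h.ex_b h0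

lemma ex_e_pos (h : C.FullAt u a b c d e) : 0 < C.ex u e :=
  (ex_nonneg h.mem_e).lt_of_ne' fun h0 => h.rotate.rotate.rotate.rotate.not_three h0 h.ex_a h.ex_b

lemma sum_ce (h : C.FullAt u a b c d e) : C.ex u c + C.ex u e = 1 := by
  have := h.sum
  rw [h.ex_a, h.ex_b, h.ex_d] at this
  linarith

end FullAt

lemma Full.card (h : C.Full u) : #(C.nbrs u) = 5 := by
  obtain ⟨a, b, c, d, e, h⟩ := h
  exact h.card

lemma Cyc5.full_cases (h : C.Cyc5 u a b c d e) (hu : C.Full u) :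
    (C.ex u a = 0 ∧ C.ex u b = 0 ∧ C.ex u d = 0) ∨ (C.ex u b = 0 ∧ C.ex u c = 0 ∧ C.ex u e = 0) ∨
    (C.ex u c = 0 ∧ C.ex u d = 0 ∧ C.ex u a = 0) ∨ (C.ex u d = 0 ∧ C.ex u e = 0 ∧ C.ex u b = 0) ∨
    (C.ex u e = 0 ∧ C.ex u a = 0 ∧ C.ex u c = 0) := by
  obtain ⟨a', b', c', d', e', h'⟩ := hu
  have h1 := h'.ex_a
  have h2 := h'.ex_b
  have h3 := h'.ex_d
  rw [← h'.next_c, ← h'.next_b, ← h'.next_a] at h3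
  rw [← h'.next_a] at h2
  rcases h.cases h'.mem with rfl | rfl | rfl | rfl | rfl <;>
  simp only [h.next_a, h.next_b, h.next_c, h.next_d, h.next_e] at h1 h2 h3 <;>
  simp only [h1, h2, h3, true_and, and_true, true_or, or_true]

variable (C) in
/-- The edge `uv` belongs to no triangle. -/
def NN (u v : V) : Prop := 0 < C.ex u v ∧ 0 < C.ex u (C.prev u v)

lemma NN.symm (hv : v ∈ C.nbrs u) (h : C.NN u v) : C.NN v u := by
  have hu := mem_nbrs_comm.1 hv
  constructor
  · refine (ex_nonneg hu).lt_of_ne' fun h0 => h.2.ne' ?_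
    have t := (tri_next hu h0).rotate
    rw [t.prev]; exact t.ex
  · refine (ex_nonneg (prev_mem hu)).lt_of_ne' fun h0 => h.1.ne' ?_
    exact (tri_prev hu h0).rotate.rotate.ex

lemma ex_add_ex_prev_lt_one (hv : v ∈ C.nbrs u) (hu : #(C.nbrs u) = 5) :
    C.ex u v + C.ex u (C.prev u v) < 1 := by
  obtain ⟨b, c, d, e, hc⟩ := exists_cyc5 hu hv
  rw [hc.prev_a]
  have := hc.sum
  have h0 := hc.ex_nonneg
  by_contra hge
  exact hc.rotate.not_three (by linarith) (by linarith) (by linarith)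

lemma NN.one_lt (hv : v ∈ C.nbrs u) (h : C.NN u v) (hu : #(C.nbrs u) = 5) :
    1 < C.ex v u + C.ex v (C.prev v u) := by
  have s1 := side hv h.1.ne'
  have s2 := side (mem_nbrs_comm.1 hv) (h.symm hv).1.ne'
  linarith [ex_add_ex_prev_lt_one hv hu]

/-- One end of an edge without triangles has degree at most four. -/
lemma NN.card_lt (hv : v ∈ C.nbrs u) (h : C.NN u v) (hu : #(C.nbrs u) = 5) : #(C.nbrs v) < 5 := by
  by_contra hc
  have hv5 : #(C.nbrs v) = 5 := by have := card_nbrs_le (C := C) v; omega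
  linarith [h.one_lt hv hu, ex_add_ex_prev_lt_one (mem_nbrs_comm.1 hv) hv5]

/-- A vertex of degree five in which every edge belongs to a triangle has at least three triangles:
fewer corners do not meet all pairs of consecutive corners of five. -/
lemma exists_nn (hu : #(C.nbrs u) = 5) (hf : ¬ C.Full u) : ∃ v ∈ C.nbrs u, C.NN u v := by
  obtain ⟨a, ha⟩ : (C.nbrs u).Nonempty := card_pos.1 (by omega)
  obtain ⟨b, c, d, e, h⟩ := exists_cyc5 hu ha
  by_contra hno
  push Not at hno
  have key : ∀ {a b c d e : V}, C.Cyc5 u a b c d e → C.ex u a = 0 ∨ C.ex u b = 0 := by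
    intro a b c d e h
    by_contra hc
    push Not at hc
    apply hno b h.mem_b
    rw [NN, h.prev_b]
    exact ⟨(ex_nonneg h.mem_b).lt_of_ne' hc.2, (ex_nonneg h.mem).lt_of_ne' hc.1⟩
  have key2 : ∀ {a b c d e : V}, C.Cyc5 u a b c d e →
      ¬ (C.ex u a = 0 ∧ C.ex u b = 0 ∧ C.ex u c = 0) ∧
      ¬ (C.ex u a = 0 ∧ C.ex u b = 0 ∧ C.ex u d = 0) := by
    intro a b c d e h
    exact ⟨fun h0 => h.not_three h0.1 h0.2.1 h0.2.2,
      fun h0 => hf ⟨_, _, _, _, _, h, h0.1, h0.2.1, h0.2.2⟩⟩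
  have h1 := h.rotate
  have h2 := h1.rotate
  have h3 := h2.rotate
  have h4 := h3.rotate
  have k0 := key h
  have k1 := key h1
  have k2 := key h2
  have k3 := key h3
  have k4 := key h4
  have q0 := key2 h
  have q1 := key2 h1
  have q2 := key2 h2
  have q3 := key2 h3
  have q4 := key2 h4
  grind only

lemma Full.not_nn (h : C.Full u) (hv : v ∈ C.nbrs u) : ¬ C.NN u v := by
  obtain ⟨b, c, d, e, hc⟩ := exists_cyc5 h.card hv
  intro hn
  have := hc.full_cases h
  rw [NN, hc.prev_a] at hn
  have h1 := hn.1.ne'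
  have h2 := hn.2.ne'
  have k0 := hc.not_three
  have k1 := hc.rotate.not_three
  have k2 := hc.rotate.rotate.not_three
  grind only

/-- A vertex of degree five that is not full, but lies in two adjacent triangles, lies in no further
triangle. -/
lemma Cyc5.ex_pos (h : C.Cyc5 u a b c d e) (ha : C.ex u a = 0) (hb : C.ex u b = 0)
    (hf : ¬ C.Full u) : 0 < C.ex u c ∧ 0 < C.ex u d ∧ 0 < C.ex u e :=
  ⟨(Config.ex_nonneg h.mem_c).lt_of_ne' fun h0 => h.not_three ha hb h0,
    (Config.ex_nonneg h.mem_d).lt_of_ne' fun h0 => hf ⟨_, _, _, _, _, h, ha, hb, h0⟩,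
    (Config.ex_nonneg h.mem_e).lt_of_ne' fun h0 =>
      h.rotate.rotate.rotate.rotate.not_three h0 ha hb⟩

/-! ### Clusters of triangles -/

/-- The two corners at `u` next to a triangle have total excess at most `1`, and `u` is full in case
of equality. -/
lemma Tri.flank_le (h : C.Tri u v w) (hu : #(C.nbrs u) = 5) :
    C.ex u w + C.ex u (C.prev u v) ≤ 1 ∧ (C.ex u w + C.ex u (C.prev u v) = 1 → C.Full u) := by
  obtain ⟨b, c, d, e, hc⟩ := exists_cyc5 hu h.mem
  obtain rfl : b = w := hc.next_a.symm.trans h.next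
  rw [hc.prev_a]
  have h1 := hc.sum
  have h2 := hc.ex_nonneg
  refine ⟨by linarith, fun h3 => ⟨_, _, _, _, _, hc.rotate.rotate, ?_, ?_, h.ex⟩⟩ <;> linarith

/-- The version of `Tri.flank_le` for two adjacent triangles at `u`. -/
lemma Tri.flank_le_two (h : C.Tri u a b) (h' : C.Tri u b c) (hu : #(C.nbrs u) = 5) :
    C.ex u c + C.ex u (C.prev u a) ≤ 1 ∧ (C.ex u c + C.ex u (C.prev u a) = 1 → C.Full u) := by
  obtain ⟨b', c', d, e, hc⟩ := exists_cyc5 hu h.mem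
  obtain rfl : b' = b := hc.next_a.symm.trans h.next
  obtain rfl : c' = c := hc.next_b.symm.trans h'.next
  rw [hc.prev_a]
  have h1 := hc.sum
  have h2 := hc.ex_nonneg
  have h3 := h.ex
  have h4 := h'.ex
  refine ⟨by linarith, fun h5 => ⟨_, _, _, _, _, hc, h3, h4, ?_⟩⟩
  linarith

/-- The side inequality on the outer side of the edge `uv` of a triangle. -/
lemma Tri.side (h : C.Tri u v w) (h0 : C.ex v u ≠ 0) : 1 ≤ C.ex v u + C.ex u (C.prev u v) :=
  Config.side (mem_nbrs_comm.1 h.mem) h0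

lemma Tri.rhombus (h : C.Tri u v w) (h0 : C.ex v u ≠ 0)
    (h1 : C.ex v u + C.ex u (C.prev u v) = 1) : C.Rhombus v u :=
  rhombus_of_ex_add (mem_nbrs_comm.1 h.mem)
    ((ex_nonneg (mem_nbrs_comm.1 h.mem)).lt_of_ne' h0) h1

/-- A triangle without adjacent triangles whose vertices all have degree five is surrounded by
rhombi, and its vertices are full. -/
lemma Tri.isolated (h : C.Tri u v w) (hu : #(C.nbrs u) = 5) (hv : #(C.nbrs v) = 5)
    (hw : #(C.nbrs w) = 5) (h1 : C.ex v u ≠ 0) (h2 : C.ex w v ≠ 0) (h3 : C.ex u w ≠ 0) :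
    (C.Full u ∧ C.Full v ∧ C.Full w) ∧ C.Rhombus v u ∧ C.Rhombus w v ∧ C.Rhombus u w := by
  have s1 := h.side h1
  have s2 := h.rotate.side h2
  have s3 := h.rotate.rotate.side h3
  obtain ⟨f1, g1⟩ := h.flank_le hu
  obtain ⟨f2, g2⟩ := h.rotate.flank_le hv
  obtain ⟨f3, g3⟩ := h.rotate.rotate.flank_le hw
  exact ⟨⟨g1 (by linarith), g2 (by linarith), g3 (by linarith)⟩, h.rhombus h1 (by linarith),
    h.rotate.rhombus h2 (by linarith), h.rotate.rotate.rhombus h3 (by linarith)⟩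

/-- No further triangle is adjacent to two adjacent triangles. -/
lemma Tri.outer_ne_zero (h : C.Tri u a b) (h' : C.Tri u b c) :
    C.ex a u ≠ 0 ∧ C.ex b a ≠ 0 ∧ C.ex c b ≠ 0 ∧ C.ex u c ≠ 0 := by
  refine ⟨fun h0 => ?_, fun h0 => ?_, fun h0 => ?_, fun h0 => ?_⟩
  · exact (tri_next (mem_nbrs_comm.1 h.mem) h0).rotate.not_three h h'
  · exact h'.rotate.not_three h.rotate.rotate (tri_next h.rotate.rotate.mem' h0)
  · exact (tri_next (mem_nbrs_comm.1 h'.rotate.mem) h0).rotate.not_three h'.rotate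
      h.rotate.rotate
  · exact h.not_three h' (tri_next h'.mem' h0)

/-- Two adjacent triangles whose vertices all have degree five are surrounded by rhombi, and their
vertices are full: the eight corners next to the sides of the two triangles would otherwise need
more angle than there is. -/
lemma Tri.diamond (h : C.Tri u a b) (h' : C.Tri u b c) (hu : #(C.nbrs u) = 5)
    (ha : #(C.nbrs a) = 5) (hb : #(C.nbrs b) = 5) (hc : #(C.nbrs c) = 5) :
    (C.Full u ∧ C.Full a ∧ C.Full b ∧ C.Full c) ∧ C.Rhombus a u ∧ C.Rhombus u c := by
  obtain ⟨n1, n2, n3, n4⟩ := h.outer_ne_zero h'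
  have s1 := h.side n1
  have s2 := h.rotate.side n2
  have s3 := h'.rotate.side n3
  have s4 := h'.rotate.rotate.side n4
  obtain ⟨f1, g1⟩ := h.flank_le_two h' hu
  obtain ⟨f2, g2⟩ := h.rotate.flank_le ha
  obtain ⟨f3, g3⟩ := h'.rotate.flank_le_two h.rotate.rotate hb
  obtain ⟨f4, g4⟩ := h'.rotate.rotate.flank_le hc
  exact ⟨⟨g1 (by linarith), g2 (by linarith), g3 (by linarith), g4 (by linarith)⟩,
    h.rhombus n1 (by linarith), h'.rotate.rotate.rhombus n4 (by linarith)⟩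

/-! ### Full vertices between two rhombi -/

lemma Tri.vec_eq (h : C.Tri u v w) : C.vec u w = C.vec u v * rot := by
  rw [← h.next]; exact vec_next_of_ex_eq_zero h.mem h.ex

/-- If the two corners of the full vertex `u` outside triangles are corners of rhombi and both `c`
and `e` are full, then `u` is the midpoint of a neighbour of `c` and a neighbour of `e`. -/
lemma FullAt.not_full_c_e (h : C.FullAt u a b c d e) (r1 : C.Rhombus u c) (r2 : C.Rhombus u e)
    (hc : C.Full c) (he : C.Full e) : False := by
  have tb := h.tri_bc
  have td := h.tri_de
  have tc := tb.rotate.rotate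
  have te := td.rotate.rotate
  obtain ⟨b', c1, c2, w, k⟩ := exists_cyc5 hc.card tc.mem
  obtain rfl : b' = b := k.next_a.symm.trans tc.next
  obtain ⟨d', e2, e1, w', l⟩ := exists_cyc5 he.card te.mem
  obtain rfl : d' = d := l.next_a.symm.trans te.next
  have kw : C.ex c w ≠ 0 := by have := r1.rotate.ex_pos; rw [k.prev_a] at this; exact this.ne'
  have kb : C.ex c b' ≠ 0 := (h.tri_ab.outer_ne_zero tb).2.2.1
  have lw : C.ex e w' ≠ 0 := by have := r2.rotate.ex_pos; rw [l.prev_a] at this; exact this.ne'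
  have k1 : C.ex c c1 = 0 ∧ C.ex c c2 = 0 := by
    have := k.full_cases hc
    grind only
  have l1 : C.ex e e1 = 0 := by
    have := l.full_cases he
    grind only
  have v1 := Tri.vec_eq ⟨k.mem_c, k.next_c, k1.1⟩
  have v2 := Tri.vec_eq ⟨k.mem_d, k.next_d, k1.2⟩
  have v3 := Tri.vec_eq ⟨l.mem_d, l.next_d, l1⟩
  have v4 := r1.vec_next
  have v5 := r2.vec_next
  rw [h.next_c, k.prev_a, v2, v1] at v4
  rw [h.next_e, l.prev_a, v3] at v5
  have v6 := h.tri_ab.vec_eq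
  have v7 := tb.vec_eq
  have v8 := td.vec_eq
  have key : C.z c1 + C.z e1 = 2 * C.z u := by
    have h1 : C.z c1 + C.z e1 - 2 * C.z u =
        C.vec u c + C.vec c c1 + (C.vec u e + C.vec e e1) := by
      simp only [vec]; ring
    have h2 : (C.z c1 + C.z e1 - 2 * C.z u) * rot ^ 2 = 0 := by
      rw [h1]
      linear_combination rot ^ 2 * v7 + rot ^ 3 * v6 - v4 + rot ^ 2 * v8 - rot * v5 +
        (C.vec u a * rot + C.vec u d') * rot_cube
    have h3 : rot ^ 2 ≠ 0 := by
      intro h0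
      have := rot_cube
      rw [pow_succ, h0] at this; norm_num at this
    have := (mul_eq_zero.1 h2).resolve_right h3
    linear_combination this
  by_cases hce : c1 = e1
  · have : c1 = u := by
      apply C.z_injective
      rw [← hce] at key
      linear_combination key / 2
    have nd := k.nodup
    simp only [List.nodup_cons, List.mem_cons] at nd
    exact nd.1 (Or.inr (Or.inl this.symm))
  · exact C.add_ne_two_mul _ _ _ hce key

/-- If the two corners of the full vertex `u` outside triangles are corners of rhombi and both `a`
and `d` are full, then `u` is the midpoint of a neighbour of `a` and a neighbour of `d`. -/
lemma FullAt.not_full_a_d (h : C.FullAt u a b c d e) (r1 : C.Rhombus u c) (r2 : C.Rhombus u e)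
    (ha : C.Full a) (hd : C.Full d) : False := by
  have ta := h.tri_ab.rotate
  have td := h.tri_de.rotate
  obtain ⟨u', w', x, y, k⟩ := exists_cyc5 ha.card ta.mem
  obtain rfl : u = u' := ta.next.symm.trans k.next_a
  obtain ⟨u', w, d1, d2, l⟩ := exists_cyc5 hd.card td.mem
  obtain rfl : u = u' := td.next.symm.trans l.next_a
  have ku : C.ex a u ≠ 0 := (h.tri_ab.outer_ne_zero h.tri_bc).1
  have ky : C.ex a y ≠ 0 := by
    intro h0
    have t : C.Tri a y b := ⟨k.mem_e, k.next_e, h0⟩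
    exact h.tri_bc.rotate.not_three h.tri_ab.rotate.rotate t.rotate.rotate
  have lu : C.ex d u ≠ 0 := by
    have := r1.ex_opposite'
    rw [h.next_c] at this
    rw [this]
    exact r1.rotate.ex_pos.ne'
  have k1 : C.ex a w' = 0 ∧ C.ex a x = 0 := by
    have := k.full_cases ha
    grind only
  have l1 : C.ex d w = 0 := by
    have := l.full_cases hd
    grind only
  have v1 := Tri.vec_eq ⟨k.mem_c, k.next_c, k1.1⟩
  have v2 := Tri.vec_eq ⟨k.mem_d, k.next_d, k1.2⟩
  have v3 := Tri.vec_eq ⟨l.mem_c, l.next_c, l1⟩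
  have v4 : C.vec a w' = C.vec u e := by
    have h1 := r2.next_next
    have h2 := r2.vec_next
    rw [h.next_e] at h1 h2
    rw [k.next_b] at h1
    rw [← h1] at h2
    have h3 := vec_add (C := C) u a w'
    have h4 := vec_add (C := C) u e w'
    linear_combination h3 - h4 - h2
  have v5 : C.vec d w = C.vec u c := by
    have h1 := r1.next_next
    have h2 := r1.vec_next
    rw [h.next_c] at h1 h2
    rw [l.next_b] at h1
    rw [← h1] at h2
    have h3 := vec_add (C := C) u d w
    have h4 := vec_add (C := C) u c w
    linear_combination h3 - h4 - h2
  have v6 := h.tri_ab.vec_eq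
  have v7 := h.tri_bc.vec_eq
  have v8 := h.tri_de.vec_eq
  have key : C.z y + C.z d1 = 2 * C.z u := by
    have h1 : C.z y + C.z d1 - 2 * C.z u =
        C.vec u a + C.vec a y + (C.vec u d + C.vec d d1) := by
      simp only [vec]; ring
    have h2 : C.z y + C.z d1 - 2 * C.z u = 0 := by
      rw [h1, v2, v1, v3, v4, v5, v7, v6, v8]
      linear_combination (C.vec u a + C.vec u d) * rot_cube
    linear_combination h2
  by_cases hyd : y = d1
  · have : y = u := by
      apply C.z_injective
      rw [← hyd] at key
      linear_combination key / 2
    have nd := k.nodup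
    simp only [List.nodup_cons, List.mem_cons] at nd
    exact nd.2.1 (Or.inr (Or.inr (Or.inl this.symm)))
  · exact C.add_ne_two_mul _ _ _ hyd key

/-- If a full vertex lies in two adjacent triangles whose vertices all have degree five, then the
other two vertices of its third triangle are not full. -/
lemma FullAt.not_full (h : C.FullAt u a b c d e) (ha : #(C.nbrs a) = 5) (hb : #(C.nbrs b) = 5)
    (hc : #(C.nbrs c) = 5) : ¬ C.Full d ∧ ¬ C.Full e := by
  obtain ⟨⟨-, fa, -, fc⟩, r1, r2⟩ := h.tri_ab.diamond h.tri_bc h.card ha hb hc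
  have r3 := r1.rotate
  rw [h.prev_a] at r3
  exact ⟨fun hd => h.not_full_a_d r2 r3 fa hd, fun he => h.not_full_c_e r2 r3 fc he⟩

/-- If all neighbours of the full vertex `u` have degree five, then its third triangle `u d e` is
adjacent to a triangle with a vertex `g` of degree at most four, and neither `d` nor `e` is full. -/
lemma FullAt.special (h : C.FullAt u a b c d e) (h5 : ∀ x ∈ C.nbrs u, #(C.nbrs x) = 5) :
    ∃ g, C.Tri e d g ∧ #(C.nbrs g) < 5 ∧ ¬ C.Full d ∧ ¬ C.Full e := by
  obtain ⟨nd, ne⟩ := h.not_full (h5 _ h.mem) (h5 _ h.mem_b) (h5 _ h.mem_c)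
  have t := h.tri_de
  have hd := h5 _ h.mem_d
  have he := h5 _ h.mem_e
  by_cases h0 : C.ex e d = 0
  · have t' := tri_next t.rotate.rotate.mem' h0
    refine ⟨_, t', ?_, nd, ne⟩
    by_contra hg
    have hg5 : #(C.nbrs (C.next e d)) = 5 := by
      have := card_nbrs_le (C := C) (C.next e d); omega
    exact ne (t.rotate.rotate.diamond t' he h.card hd hg5).1.1
  · exfalso
    have n1 : C.ex d u ≠ 0 := by
      intro h1
      have t1 := (tri_next t.rotate.mem' h1).rotate
      have t2 := t1.ex
      rw [← t1.prev, h.prev_d] at t2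
      exact h.ex_c_pos.ne' t2
    exact nd (t.isolated h.card hd he n1 h0 h.ex_e_pos.ne').1.2.1

/-! ### Tight vertices -/

variable (C) in
/-- A vertex `w` of degree four is tight if its four neighbours have degree five and have no other
neighbour of degree at most four. -/
structure Tight (w : V) : Prop where
  card : #(C.nbrs w) = 4
  card_nbr : ∀ v ∈ C.nbrs w, #(C.nbrs v) = 5
  unique : ∀ v ∈ C.nbrs w, ∀ x ∈ C.nbrs v, #(C.nbrs x) < 5 → x = w

lemma ex_prev_eq_zero (hv : v ∈ C.nbrs u) (h : C.ex v u = 0) : C.ex u (C.prev u v) = 0 := by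
  have t := (tri_next (mem_nbrs_comm.1 hv) h).rotate
  rw [t.prev]; exact t.ex

lemma Full.exists_fullAt (hu : C.Full u) (h : C.Tri u a b) (h' : C.Tri u b c) :
    ∃ d e, C.FullAt u a b c d e := by
  obtain ⟨b', c', d, e, k⟩ := exists_cyc5 hu.card h.mem
  obtain rfl : b = b' := h.next.symm.trans k.next_a
  obtain rfl : c = c' := h'.next.symm.trans k.next_b
  refine ⟨d, e, k, h.ex, h'.ex, ?_⟩
  have h1 := k.not_three h.ex h'.ex
  have h2 : C.ex u e ≠ 0 := fun h0 => k.rotate.rotate.rotate.rotate.not_three h0 h.ex h'.ex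
  have := k.full_cases hu
  grind only

namespace Tight

lemma card_eq (hw : C.Tight w) (hv : v ∈ C.nbrs w) {x : V} (hx : x ∈ C.nbrs v) (hne : x ≠ w) :
    #(C.nbrs x) = 5 := by
  have h1 := card_nbrs_le (C := C) x
  by_contra h
  exact hne (hw.unique v hv x hx (by omega))

lemma eq_of_nn (hw : C.Tight w) (hv : v ∈ C.nbrs w) {x : V} (hx : x ∈ C.nbrs v)
    (h : C.NN v x) : x = w :=
  hw.unique v hv x hx (h.card_lt hx (hw.card_nbr v hv))

lemma full (hw : C.Tight w) (hv : v ∈ C.nbrs w) (h : ¬ C.NN w v) : C.Full v := by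
  by_contra hf
  obtain ⟨x, hx, hn⟩ := exists_nn (hw.card_nbr v hv) hf
  obtain rfl := hw.eq_of_nn hv hx hn
  exact h (hn.symm hx)

/-- If the two other vertices of a triangle with the vertex `w` are full, then the triangle is
adjacent to another one across the side opposite to `w`. -/
lemma ex_eq_zero (hw : C.Tight w) (t : C.Tri w v y) (fv : C.Full v) (fy : C.Full y)
    (h : C.ex w (C.prev w v) ≠ 0) : C.ex y v = 0 := by
  by_contra h0
  have t' := t.rotate
  have hvw : C.ex v w ≠ 0 := fun h1 => h (ex_prev_eq_zero t.mem h1)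
  obtain ⟨a, b, c, d, e, k⟩ := fv
  have kc := k.ex_c_pos.ne'
  have ke := k.ex_e_pos.ne'
  rcases k.cases t'.mem with rfl | rfl | rfl | rfl | rfl
  · have : b = w := k.next_a.symm.trans t'.next
    rw [← this] at hvw
    exact hvw k.ex_b
  · exact h0 k.tri_ab.rotate.rotate.ex
  · exact kc t'.ex
  · obtain rfl : e = w := k.next_d.symm.trans t'.next
    have nd := k.nodup
    simp only [List.nodup_cons, List.mem_cons] at nd
    refine (k.not_full (hw.card_eq t.mem k.mem ?_) (hw.card_eq t.mem k.mem_b ?_)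
      (hw.card_eq t.mem k.mem_c ?_)).1 fy <;> rintro rfl <;> simp at nd
  · exact ke t'.ex

/-- The two full vertices of a triangle with the vertex `w` belong to a second triangle, and its
third vertex has degree five. Its angles bound those of the corners next to the first triangle. -/
lemma exists_apex (hw : C.Tight w) (t : C.Tri w v y) (fv : C.Full v) (fy : C.Full y)
    (h : C.ex w (C.prev w v) ≠ 0) :
    ∃ x, C.Tri y v x ∧ C.ex y (C.prev y w) + C.ex v w ≤ 1 := by
  have t1 := tri_next t.rotate.rotate.mem' (hw.ex_eq_zero t fv fy h)
  refine ⟨_, t1, ?_⟩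
  set x := C.next y v
  obtain ⟨d, e, ky⟩ := fy.exists_fullAt t.rotate.rotate t1
  obtain ⟨d', e', kv⟩ := fv.exists_fullAt t1.rotate t.rotate
  have hx : #(C.nbrs x) = 5 := by
    apply hw.card_eq t.mem t1.rotate.mem
    have nd := ky.nodup
    rintro h0
    rw [h0] at nd
    simp at nd
  obtain ⟨n1, -, -, n4⟩ := t.rotate.rotate.outer_ne_zero t1
  obtain ⟨n1', -, -, n4'⟩ := t1.rotate.outer_ne_zero t.rotate
  have s1 := t1.rotate.rotate.side n4
  have s2 := t1.rotate.side n1'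
  have f := (t1.rotate.rotate.flank_le hx).1
  have q1 := ky.sum_ce
  have q2 := kv.sum_ce
  rw [ky.prev_a]
  rw [kv.prev_a] at s2
  linarith

/-- In two adjacent triangles at `w`, the vertices `a` and `b` are full, which forces a third
triangle across the side `ab`. -/
lemma false_of_two_adjacent (hw : C.Tight w) (k : C.Cyc4 w a b c d) (ha : C.ex w a = 0)
    (hb : C.ex w b = 0) : False := by
  have hd : C.ex w d ≠ 0 := fun h0 => k.rotate.rotate.rotate.not_three h0 ha hb
  have ta : C.Tri w a b := ⟨k.mem, k.next_a, ha⟩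
  have tb : C.Tri w b c := ⟨k.mem_b, k.next_b, hb⟩
  have fa : C.Full a := hw.full k.mem fun h => h.1.ne' ha
  have fb : C.Full b := hw.full k.mem_b fun h => h.1.ne' hb
  exact (ta.outer_ne_zero tb).2.1 (hw.ex_eq_zero ta fa fb (by rwa [k.prev_a]))

/-- Two opposite edges without triangles need too much angle. -/
lemma false_of_no_triangle (hw : C.Tight w) (k : C.Cyc4 w a b c d) (ha : C.ex w a ≠ 0)
    (hb : C.ex w b ≠ 0) (hc : C.ex w c ≠ 0) (hd : C.ex w d ≠ 0) : False := by
  have pa := (ex_nonneg k.mem).lt_of_ne' ha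
  have pb := (ex_nonneg k.mem_b).lt_of_ne' hb
  have pc := (ex_nonneg k.mem_c).lt_of_ne' hc
  have pd := (ex_nonneg k.mem_d).lt_of_ne' hd
  have na : C.NN w a := ⟨pa, by rwa [k.prev_a]⟩
  have nc : C.NN w c := ⟨pc, by rwa [k.prev_c]⟩
  have h1 := (na.symm k.mem).one_lt (mem_nbrs_comm.1 k.mem) (hw.card_nbr a k.mem)
  have h2 := (nc.symm k.mem_c).one_lt (mem_nbrs_comm.1 k.mem_c) (hw.card_nbr c k.mem_c)
  rw [k.prev_a] at h1
  rw [k.prev_c] at h2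
  linarith [k.sum]

/-- If a neighbour `v` of `w` is not full, then a triangle at `v` that does not contain `w` and
has no adjacent triangle at `v` has one across its side opposite to `v`. -/
lemma ex_eq_zero_of_not_full (hw : C.Tight w) (hv : v ∈ C.nbrs w) (t : C.Tri v a b)
    (hf : ¬ C.Full v) (ha : a ≠ w) (hb : b ≠ w) (h1 : C.ex a v ≠ 0) (h2 : C.ex v b ≠ 0) :
    C.ex b a = 0 := by
  by_contra h0
  exact hf (t.isolated (hw.card_nbr v hv) (hw.card_eq hv t.mem ha) (hw.card_eq hv t.mem' hb)
    h1 h0 h2).1.1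

/-- The two edges `wc` and `wd` outside triangles span a corner which is too narrow not to belong to
a rhombus; and the fourth vertex of that rhombus would lie in three consecutive triangles. -/
lemma false_of_one_triangle (hw : C.Tight w) (k : C.Cyc4 w a b c d) (ha : C.ex w a = 0)
    (hb : C.ex w b ≠ 0) (hc : C.ex w c ≠ 0) (hd : C.ex w d ≠ 0) : False := by
  have pb := (ex_nonneg k.mem_b).lt_of_ne' hb
  have pc := (ex_nonneg k.mem_c).lt_of_ne' hc
  have pd := (ex_nonneg k.mem_d).lt_of_ne' hd
  have ta : C.Tri w a b := ⟨k.mem, k.next_a, ha⟩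
  have fa : C.Full a := hw.full k.mem fun h => h.1.ne' ha
  have fb : C.Full b := hw.full k.mem_b fun h => h.2.ne' (by rwa [k.prev_b])
  have nc : C.NN w c := ⟨pc, by rwa [k.prev_c]⟩
  have nd : C.NN w d := ⟨pd, by rwa [k.prev_d]⟩
  have wc := mem_nbrs_comm.1 k.mem_c
  have wd := mem_nbrs_comm.1 k.mem_d
  have nc' := nc.symm k.mem_c
  have nd' := nd.symm k.mem_d
  have fc : ¬ C.Full c := fun h => h.not_nn wc nc'
  have fd : ¬ C.Full d := fun h => h.not_nn wd nd'
  obtain ⟨x, tx, hx⟩ := hw.exists_apex ta fa fb (by rwa [k.prev_a])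
  have s1 := side k.mem_b hb
  have s2 := side (mem_nbrs_comm.1 k.mem) (tx.rotate.outer_ne_zero ta.rotate).2.2.2
  have s3 := side wc nc'.1.ne'
  have s4 := side k.mem_d hd
  have g1 := ex_add_ex_prev_lt_one wc (hw.card_nbr c k.mem_c)
  have g2 := ex_add_ex_prev_lt_one wd (hw.card_nbr d k.mem_d)
  rw [k.prev_a] at s2
  rw [k.prev_c] at s3
  rcases rhombus_or_gap k.mem_c pc with r | r
  · -- The triangles at `c` and `d` next to the rhombus both contain its fourth vertex `r'`, and
    -- each of them is adjacent to one more triangle at `r'`.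
    obtain ⟨c1, c2, c3, r', lc⟩ := exists_cyc5 (hw.card_nbr c k.mem_c) wc
    obtain ⟨r'', d1, d2, d3, ld⟩ := exists_cyc5 (hw.card_nbr d k.mem_d) wd
    have e1 := r.next_next
    have e2 := r.next_prev_next
    have e3 := r.ex_opposite
    rw [k.next_c, lc.prev_a] at e1 e2 e3
    obtain rfl : r' = r'' := e1.symm.trans ld.next_a
    have ndc := lc.nodup
    have ndd := ld.nodup
    simp only [List.nodup_cons, List.mem_cons, List.not_mem_nil, or_false, not_or] at ndc ndd
    have zc : C.ex c c3 = 0 := by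
      by_contra h0
      apply ndc.1.2.2.2
      refine (hw.eq_of_nn k.mem_c lc.mem_e ⟨?_, ?_⟩).symm
      · have := nc'.2; rwa [lc.prev_a] at this
      · rw [lc.prev_e]; exact (ex_nonneg lc.mem_d).lt_of_ne' h0
    have zc1 : C.ex c c1 = 0 := by
      by_contra h0
      apply ndc.1.1
      refine (hw.eq_of_nn k.mem_c lc.mem_b ⟨(ex_nonneg lc.mem_b).lt_of_ne' h0, ?_⟩).symm
      rw [lc.prev_b]; exact nc'.1
    have zd : C.ex d r' = 0 := by
      by_contra h0
      apply ndd.1.1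
      refine (hw.eq_of_nn k.mem_d ld.mem_b ⟨(ex_nonneg ld.mem_b).lt_of_ne' h0, ?_⟩).symm
      rw [ld.prev_b]; exact nd'.1
    have zd2 : C.ex d d2 = 0 := by
      by_contra h0
      apply ndd.1.2.2.2
      refine (hw.eq_of_nn k.mem_d ld.mem_e ⟨?_, ?_⟩).symm
      · have := nd'.2; rwa [ld.prev_a] at this
      · rw [ld.prev_e]; exact (ex_nonneg ld.mem_d).lt_of_ne' h0
    have tc : C.Tri c c3 r' := ⟨lc.mem_d, lc.next_d, zc⟩
    have td : C.Tri d r' d1 := ⟨ld.mem_b, ld.next_b, zd⟩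
    have oc : C.ex r' c3 = 0 := by
      refine hw.ex_eq_zero_of_not_full k.mem_c tc fc (Ne.symm ndc.1.2.2.1)
        (Ne.symm ndc.1.2.2.2) (fun h0 => ?_) ?_
      · have := ex_prev_eq_zero tc.mem h0
        rw [lc.prev_d] at this
        exact lc.rotate.not_three zc1 this zc
      · have := nc'.2; rw [lc.prev_a] at this; exact this.ne'
    have od : C.ex d1 r' = 0 := by
      refine hw.ex_eq_zero_of_not_full k.mem_d td fd (Ne.symm ndd.1.1)
        (Ne.symm ndd.1.2.1) ?_ (fun h0 => ?_)
      · rw [← e3] at hc; exact hc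
      · exact ld.rotate.not_three zd h0 zd2
    obtain ⟨c3', g, h, d', lr⟩ := exists_cyc5 (hw.card_eq k.mem_c lc.mem_e
      (Ne.symm ndc.1.2.2.2)) tc.rotate.rotate.mem
    obtain rfl : c3 = c3' := tc.rotate.rotate.next.symm.trans lr.next_a
    obtain rfl : d = d' := by rw [← lr.prev_a, ← e2, prev_next (mem_nbrs_comm.1 td.mem)]
    obtain rfl : d1 = h := by rw [← lr.prev_e, td.rotate.prev]
    have zg := ex_prev_eq_zero td.rotate.mem od
    rw [lr.prev_d] at zg
    exact lr.not_three tc.rotate.rotate.ex oc zg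
  · rw [k.next_c] at r
    linarith [k.sum]

/-- A rhombus between the two triangles at `w` leads to an isolated triangle at its fourth vertex
`r`, which makes `r` a full vertex between two rhombi. -/
lemma not_rhombus (hw : C.Tight w) (k : C.Cyc4 w a b c d) (ha : C.ex w a = 0)
    (hb : C.ex w b ≠ 0) (hc : C.ex w c = 0) (hd : C.ex w d ≠ 0) : ¬ C.Rhombus w b := by
  intro rh
  have ta : C.Tri w a b := ⟨k.mem, k.next_a, ha⟩
  have tc : C.Tri w c d := ⟨k.mem_c, k.next_c, hc⟩
  have fa : C.Full a := hw.full k.mem fun h => h.1.ne' ha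
  have fb : C.Full b := hw.full k.mem_b fun h => h.2.ne' (by rwa [k.prev_b])
  have fc : C.Full c := hw.full k.mem_c fun h => h.1.ne' hc
  have fd : C.Full d := hw.full k.mem_d fun h => h.2.ne' (by rwa [k.prev_d])
  obtain ⟨x, tx, -⟩ := hw.exists_apex ta fa fb (by rwa [k.prev_a])
  obtain ⟨x', tx', -⟩ := hw.exists_apex tc fc fd (by rwa [k.prev_c])
  obtain ⟨e, r, kb⟩ := fb.exists_fullAt ta.rotate.rotate tx
  obtain ⟨r', f, kc⟩ := fc.exists_fullAt tx'.rotate tc.rotate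
  have e1 := rh.next_next
  have e2 := rh.next_prev_next
  have e3 := rh.ex_opposite
  rw [k.next_b, kb.prev_a] at e1 e2 e3
  obtain rfl : r = r' := e1.symm.trans kc.next_c
  have r1 := rh.rotate
  rw [kb.prev_a] at r1
  have ndb := kb.nodup
  have ndc := kc.nodup
  simp only [List.nodup_cons, List.mem_cons, List.not_mem_nil, or_false, not_or] at ndb ndc
  have hr := hw.card_eq k.mem_b kb.mem_e (Ne.symm ndb.1.2.2.2)
  have he := hw.card_eq k.mem_b kb.mem_d (Ne.symm ndb.1.2.2.1)
  have hf := hw.card_eq k.mem_c kc.mem_e (Ne.symm ndc.2.2.1.2)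
  have tb := kb.tri_de
  have td := kc.tri_de
  obtain ⟨b', e', g, f', kr⟩ := exists_cyc5 hr (mem_nbrs_comm.1 kc.mem_d)
  obtain rfl : b = b' := e2.symm.trans kr.next_a
  obtain rfl : e = e' := tb.rotate.rotate.next.symm.trans kr.next_b
  obtain rfl : f = f' := by rw [← kr.prev_a, td.rotate.prev]
  have r2 := r1.rotate
  rw [kr.prev_b] at r2
  have n1 : C.ex e b ≠ 0 := fun h0 => by
    have := ex_prev_eq_zero kb.mem_d h0
    rw [kb.prev_d] at this
    exact kb.ex_c_pos.ne' this
  by_cases h0 : C.ex r e = 0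
  · have n2 : C.ex f r ≠ 0 := fun h1 => by
      have := ex_prev_eq_zero td.rotate.mem h1
      rw [kr.prev_e] at this
      exact kr.rotate.not_three tb.rotate.rotate.ex h0 this
    obtain ⟨⟨-, -, ff⟩, -, r3, -⟩ := td.isolated fc.card hr hf (e3 ▸ hb) n2 kc.ex_e_pos.ne'
    have r4 := r3.rotate
    rw [kr.prev_e] at r4
    have kr' : C.FullAt r b e g f c := ⟨kr.rotate, tb.rotate.rotate.ex, h0, td.rotate.ex⟩
    exact kr'.not_full_a_d r4 r2 fb ff
  · obtain ⟨⟨-, fe, fr⟩, -, r3, -⟩ := tb.isolated fb.card he hr n1 h0 kb.ex_e_pos.ne'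
    have zg : C.ex r g = 0 := by
      have := kr.full_cases fr
      have n2 : C.ex r c ≠ 0 := e3 ▸ hb
      grind only
    have kr' : C.FullAt r g f c b e :=
      ⟨kr.rotate.rotate.rotate, zg, td.rotate.ex, tb.rotate.rotate.ex⟩
    exact kr'.not_full_c_e r2 r3 fc fe

/-- Neither of the corners between the two triangles belongs to a rhombus, so both are wide, and
there is not enough angle. -/
lemma false_of_two_opposite (hw : C.Tight w) (k : C.Cyc4 w a b c d) (ha : C.ex w a = 0)
    (hb : C.ex w b ≠ 0) (hc : C.ex w c = 0) (hd : C.ex w d ≠ 0) : False := by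
  have ta : C.Tri w a b := ⟨k.mem, k.next_a, ha⟩
  have tc : C.Tri w c d := ⟨k.mem_c, k.next_c, hc⟩
  have fa : C.Full a := hw.full k.mem fun h => h.1.ne' ha
  have fb : C.Full b := hw.full k.mem_b fun h => h.2.ne' (by rwa [k.prev_b])
  have fc : C.Full c := hw.full k.mem_c fun h => h.1.ne' hc
  have fd : C.Full d := hw.full k.mem_d fun h => h.2.ne' (by rwa [k.prev_d])
  obtain ⟨x, -, hx⟩ := hw.exists_apex ta fa fb (by rwa [k.prev_a])
  obtain ⟨x', -, hx'⟩ := hw.exists_apex tc fc fd (by rwa [k.prev_c])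
  have g1 := (rhombus_or_gap k.mem_b ((ex_nonneg k.mem_b).lt_of_ne' hb)).resolve_left
    (hw.not_rhombus k ha hb hc hd)
  have g2 := (rhombus_or_gap k.mem_d ((ex_nonneg k.mem_d).lt_of_ne' hd)).resolve_left
    (hw.not_rhombus k.rotate.rotate hc hd ha hb)
  rw [k.next_b] at g1
  rw [k.next_d] at g2
  linarith [k.sum]

end Tight

/-- There are no tight vertices. -/
lemma not_tight (w : V) : ¬ C.Tight w := by
  intro hw
  obtain ⟨a, ha⟩ : (C.nbrs w).Nonempty := card_pos.1 (by have := hw.card; omega)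
  obtain ⟨b, c, d, k⟩ := exists_cyc4 hw.card ha
  have k1 := k.rotate
  have k2 := k1.rotate
  have k3 := k2.rotate
  have a0 := hw.false_of_two_adjacent k
  have a1 := hw.false_of_two_adjacent k1
  have a2 := hw.false_of_two_adjacent k2
  have a3 := hw.false_of_two_adjacent k3
  have b0 := hw.false_of_two_opposite k
  have b1 := hw.false_of_two_opposite k1
  have c0 := hw.false_of_one_triangle k
  have c1 := hw.false_of_one_triangle k1
  have c2 := hw.false_of_one_triangle k2
  have c3 := hw.false_of_one_triangle k3
  have d0 := hw.false_of_no_triangle k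
  grind only

/-! ### Discharging -/

variable (C) in
open Classical in
/-- The neighbours of `v` of degree at most four. -/
noncomputable def lowNbrs (v : V) : Finset V := (C.nbrs v).filter fun x => #(C.nbrs x) < 5

variable (C) in
open Classical in
/-- The neighbours of `v` joined to it by an edge outside all triangles. -/
noncomputable def nnNbrs (v : V) : Finset V := (C.nbrs v).filter fun x => C.NN v x

variable (C) in
/-- The neighbours from which a vertex `v` of degree five receives a charge: those across edges
outside all triangles if there are at least two of these, and otherwise all of degree at most
four. -/
noncomputable def payers (v : V) : Finset V :=
  if 2 ≤ #(C.nnNbrs v) then C.nnNbrs v else C.lowNbrs v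

variable (C) in
open Classical in
/-- The charge that `w` gives to `v`: the payers of a vertex of degree five share a unit equally. -/
noncomputable def pay (w v : V) : ℝ :=
  if #(C.nbrs v) = 5 ∧ w ∈ C.payers v then 1 / #(C.payers v) else 0

variable (C) in
open Classical in
/-- The neighbours `d` of `g` that, together with the preceding neighbour `e`, form the common side
of a triangle at `g` and of another triangle, where `d` and `e` have degree five and are not
full. -/
noncomputable def specials (g : V) : Finset V := (C.nbrs g).filter fun d =>
  ∃ e v, C.Tri v d e ∧ C.Tri e d g ∧ (#(C.nbrs d) = 5 ∧ ¬ C.Full d) ∧ #(C.nbrs e) = 5 ∧ ¬ C.Full e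

lemma nnNbrs_subset (hv : #(C.nbrs v) = 5) : C.nnNbrs v ⊆ C.lowNbrs v := by
  intro x hx
  simp only [nnNbrs, lowNbrs, mem_filter] at hx ⊢
  exact ⟨hx.1, hx.2.card_lt hx.1 hv⟩

lemma payers_subset (hv : #(C.nbrs v) = 5) : C.payers v ⊆ C.lowNbrs v := by
  rw [payers]
  split_ifs
  · exact nnNbrs_subset hv
  · exact Subset.rfl

lemma pay_nonneg (w v : V) : 0 ≤ C.pay w v := by
  rw [pay]; split_ifs <;> positivity

lemma pay_le_one (w v : V) : C.pay w v ≤ 1 := by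
  rw [pay]
  split_ifs with h
  · have : (1 : ℝ) ≤ #(C.payers v) := by exact_mod_cast card_pos.2 ⟨w, h.2⟩
    rw [div_le_one (by linarith)]; exact this
  · exact zero_le_one

lemma pay_le_half (h : 2 ≤ #(C.lowNbrs v)) : C.pay w v ≤ 1 / 2 := by
  have h2 : 2 ≤ #(C.payers v) := by
    rw [payers]; split_ifs with h'
    · exact h'
    · exact h
  rw [pay]
  split_ifs
  · have : (2 : ℝ) ≤ #(C.payers v) := by exact_mod_cast h2
    exact one_div_le_one_div_of_le (by norm_num) this
  · norm_num

/-- A vertex of degree five that is not full, but lies in two adjacent triangles, has two edges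
outside all triangles. -/
lemma payers_eq_nnNbrs (hu : #(C.nbrs u) = 5) (hf : ¬ C.Full u) (h : C.Tri u a b)
    (h' : C.Tri u b c) : C.payers u = C.nnNbrs u := by
  classical
  obtain ⟨b', c', d, e, k⟩ := exists_cyc5 hu h.mem
  obtain rfl : b = b' := h.next.symm.trans k.next_a
  obtain rfl : c = c' := h'.next.symm.trans k.next_b
  obtain ⟨pc, pd, pe⟩ := k.ex_pos h.ex h'.ex hf
  rw [payers, if_pos]
  have hde : d ≠ e := by
    have := k.nodup
    simp only [List.nodup_cons, List.mem_cons, List.not_mem_nil, or_false, not_or] at this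
    exact this.2.2.2.1
  rw [← card_pair hde]
  apply card_le_card
  intro x hx
  rw [mem_insert, mem_singleton] at hx
  rw [nnNbrs, mem_filter]
  rcases hx with rfl | rfl
  · exact ⟨k.mem_d, pd, by rwa [k.prev_d]⟩
  · exact ⟨k.mem_e, pe, by rwa [k.prev_e]⟩

lemma pay_eq_zero_of_mem_specials (h : d ∈ C.specials g) :
    C.pay g d = 0 ∧ C.pay g (C.prev g d) = 0 ∧ C.Tri g (C.prev g d) d := by
  classical
  rw [specials, mem_filter] at h
  obtain ⟨-, e, v, t, t', ⟨hd, fd⟩, he, fe⟩ := h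
  have tg := t'.rotate.rotate
  rw [tg.prev]
  refine ⟨?_, ?_, tg⟩
  · rw [pay, if_neg]
    rintro ⟨-, hp⟩
    rw [payers_eq_nnNbrs hd fd t'.rotate t.rotate, nnNbrs, mem_filter] at hp
    exact hp.2.1.ne' t'.rotate.ex
  · rw [pay, if_neg]
    rintro ⟨-, hp⟩
    rw [payers_eq_nnNbrs he fe t.rotate.rotate t', nnNbrs, mem_filter] at hp
    have := hp.2.2.ne'
    rw [t'.prev] at this
    exact this t'.ex

/-- A vertex of degree `k ≤ 4` gives away at most `9 / 2 * (5 - k) - 1`, where a unit is counted for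
each member of `specials` in addition to the payments. -/
lemma sum_pay_le (hg : #(C.nbrs g) < 5) :
    ∑ v ∈ C.nbrs g, C.pay g v + #(C.specials g) ≤ 9 / 2 * (5 - #(C.nbrs g)) - 1 := by
  classical
  have hsub : C.specials g ⊆ C.nbrs g := filter_subset _ _
  -- Every set of neighbours that receive nothing improves the trivial bound.
  have bound : ∀ Y ⊆ C.nbrs g, (∀ v ∈ Y, C.pay g v = 0) →
      ∑ v ∈ C.nbrs g, C.pay g v ≤ #(C.nbrs g) - #Y := by
    intro Y hY h0
    rw [← sum_sdiff hY, sum_eq_zero h0, add_zero, ← Nat.cast_sub (card_le_card hY),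
      ← card_sdiff_of_subset hY]
    calc _ ≤ ∑ v ∈ C.nbrs g \ Y, (1 : ℝ) := sum_le_sum fun v _ => pay_le_one g v
      _ = _ := by simp
  rcases (show #(C.nbrs g) ≤ 3 ∨ #(C.nbrs g) = 4 by omega) with h3 | h4
  · have h1 := bound ∅ (empty_subset _) (by simp)
    have h2 : (#(C.specials g) : ℝ) ≤ #(C.nbrs g) := by exact_mod_cast card_le_card hsub
    have h3' : (#(C.nbrs g) : ℝ) ≤ 3 := by exact_mod_cast h3
    simp only [card_empty, Nat.cast_zero, sub_zero] at h1
    linarith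
  rw [h4]
  by_cases hZ : C.specials g = ∅
  · obtain ⟨v, hv, hp⟩ : ∃ v ∈ C.nbrs g, C.pay g v ≤ 1 / 2 := by
      by_contra hc
      push Not at hc
      refine not_tight g ⟨h4, fun v hv => ?_, fun v hv x hx hx5 => ?_⟩
      · by_contra h5
        have := hc v hv
        rw [pay, if_neg (fun h => h5 h.1)] at this
        norm_num at this
      · by_contra hne
        refine absurd (hc v hv) (not_lt.2 (pay_le_half ?_))
        rw [← card_pair hne]
        apply card_le_card
        intro y hy
        rw [mem_insert, mem_singleton] at hy
        rw [lowNbrs, mem_filter]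
        rcases hy with rfl | rfl
        · exact ⟨hx, hx5⟩
        · exact ⟨mem_nbrs_comm.1 hv, hg⟩
    rw [hZ, ← add_sum_erase _ _ hv]
    have h1 : ∑ x ∈ (C.nbrs g).erase v, C.pay g x ≤ ∑ x ∈ (C.nbrs g).erase v, (1 : ℝ) :=
      sum_le_sum fun x _ => pay_le_one g x
    rw [sum_const, card_erase_of_mem hv, h4] at h1
    norm_num at h1 ⊢
    linarith
  · -- The neighbours preceding the special ones also receive nothing, and one of them is not
    -- special, as there are no three consecutive triangles.
    obtain ⟨d, hd, hpd⟩ : ∃ d ∈ C.specials g, C.prev g d ∉ C.specials g := by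
      by_contra hc
      push Not at hc
      obtain ⟨d, hd⟩ := nonempty_iff_ne_empty.2 hZ
      have t1 := (pay_eq_zero_of_mem_specials hd).2.2
      have t2 := (pay_eq_zero_of_mem_specials (hc _ hd)).2.2
      have t3 := (pay_eq_zero_of_mem_specials (hc _ (hc _ hd))).2.2
      exact t3.not_three t2 t1
    have h1 := bound (insert (C.prev g d) (C.specials g))
      (insert_subset (prev_mem (hsub hd)) hsub) (by
        intro v hv
        rcases mem_insert.1 hv with rfl | hv
        · exact (pay_eq_zero_of_mem_specials hd).2.1
        · exact (pay_eq_zero_of_mem_specials hv).1)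
    rw [card_insert_of_notMem hpd, h4] at h1
    push_cast at h1 ⊢
    linarith

/-- A vertex of degree five receives a total charge of `1`, unless all its neighbours have degree
five, in which case it is counted among the special pairs. -/
lemma one_le_sum_pay (hv : #(C.nbrs v) = 5) :
    1 ≤ ∑ w, C.pay w v ∨ ∃ g d, #(C.nbrs g) < 5 ∧ d ∈ C.specials g ∧
      C.next d (C.next d g) = v := by
  classical
  by_cases hp : (C.payers v).Nonempty
  · left
    have h1 : ∑ w, C.pay w v = ∑ w ∈ C.payers v, (1 / #(C.payers v) : ℝ) := by
      rw [← sum_filter_add_sum_filter_not univ (fun w => w ∈ C.payers v)]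
      rw [sum_eq_zero (s := univ.filter fun w => w ∉ C.payers v), add_zero]
      · rw [filter_mem_eq_inter, univ_inter]
        apply sum_congr rfl
        intro w hw
        rw [pay, if_pos ⟨hv, hw⟩]
      · intro w hw
        rw [pay, if_neg]
        exact fun h => (mem_filter.1 hw).2 h.2
    rw [h1, sum_const, nsmul_eq_mul, mul_one_div_cancel]
    exact_mod_cast (card_pos.2 hp).ne'
  · right
    rw [not_nonempty_iff_eq_empty] at hp
    have hl : C.lowNbrs v = ∅ := by
      rw [payers] at hp
      split_ifs at hp with h2
      · rw [hp] at h2; simp at h2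
      · exact hp
    have h5 : ∀ x ∈ C.nbrs v, #(C.nbrs x) = 5 := by
      intro x hx
      by_contra hne
      have h1 := card_nbrs_le (C := C) x
      have : x ∈ C.lowNbrs v := by rw [lowNbrs, mem_filter]; exact ⟨hx, by omega⟩
      rw [hl] at this; simp at this
    have hf : C.Full v := by
      by_contra hf
      obtain ⟨x, hx, hn⟩ := exists_nn hv hf
      have := hn.card_lt hx hv
      have := h5 x hx
      omega
    obtain ⟨a, b, c, d, e, k⟩ := hf
    obtain ⟨g, t, hg, fd, fe⟩ := k.special h5
    refine ⟨g, d, hg, ?_, ?_⟩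
    · rw [specials, mem_filter]
      exact ⟨t.rotate.rotate.mem', e, v, k.tri_de, t, ⟨h5 _ k.mem_d, fd⟩, h5 _ k.mem_e, fe⟩
    · rw [t.rotate.next, k.tri_de.rotate.next]

/-- The degrees are at most `43 / 9` on average. -/
theorem sum_card_nbrs_le (C : Config V) :
    (∑ v, #(C.nbrs v) : ℝ) ≤ 43 * Fintype.card V / 9 := by
  classical
  set low : Finset V := univ.filter fun v => #(C.nbrs v) < 5 with hlow
  set high : Finset V := univ.filter fun v => ¬ #(C.nbrs v) < 5 with hhigh
  have h5 : ∀ v ∈ high, #(C.nbrs v) = 5 := by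
    intro v hv
    have h1 := (mem_filter.1 hv).2
    have h2 := card_nbrs_le (C := C) v
    omega
  set paid := high.filter fun v => 1 ≤ ∑ w, C.pay w v with hpaid
  set unpaid := high.filter fun v => ¬ 1 ≤ ∑ w, C.pay w v with hunpaid
  have e1 : (#paid : ℝ) ≤ ∑ w ∈ low, ∑ v ∈ C.nbrs w, C.pay w v := by
    calc (#paid : ℝ) = ∑ v ∈ paid, (1 : ℝ) := by simp
      _ ≤ ∑ v ∈ paid, ∑ w, C.pay w v := sum_le_sum fun v hv => (mem_filter.1 hv).2
      _ ≤ ∑ v, ∑ w, C.pay w v :=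
        sum_le_sum_of_subset_of_nonneg (subset_univ _) fun v _ _ =>
          sum_nonneg fun w _ => pay_nonneg w v
      _ = ∑ w, ∑ v, C.pay w v := sum_comm
      _ = ∑ w ∈ low, ∑ v ∈ C.nbrs w, C.pay w v := by
        have pz : ∀ w v, C.pay w v ≠ 0 → w ∈ low ∧ v ∈ C.nbrs w := by
          intro w v h
          rw [pay] at h
          split_ifs at h with h'
          · have := payers_subset h'.1 h'.2
            rw [lowNbrs, mem_filter] at this
            exact ⟨mem_filter.2 ⟨mem_univ _, this.2⟩, mem_nbrs_comm.1 this.1⟩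
          · exact absurd rfl h
        symm
        rw [sum_subset (subset_univ low)]
        · apply sum_congr rfl
          intro w _
          apply sum_subset (subset_univ _)
          intro v _ hv
          by_contra h
          exact hv (pz w v h).2
        · intro w _ hw
          apply sum_eq_zero
          intro v _
          by_contra h
          exact hw (pz w v h).1
  have e2 : (#unpaid : ℝ) ≤ ∑ w ∈ low, (#(C.specials w) : ℝ) := by
    rw [← Nat.cast_sum, ← card_sigma]
    norm_cast
    refine (card_le_card (t := (low.sigma C.specials).image
      fun x => C.next x.2 (C.next x.2 x.1)) ?_).trans card_image_le
    intro v hv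
    obtain ⟨hv1, hv2⟩ := mem_filter.1 hv
    obtain ⟨g, d, hg, hd, rfl⟩ := (one_le_sum_pay (h5 v hv1)).resolve_left hv2
    exact mem_image.2 ⟨⟨g, d⟩, mem_sigma.2 ⟨mem_filter.2 ⟨mem_univ _, hg⟩, hd⟩, rfl⟩
  have e3 : ∑ w ∈ low, ∑ v ∈ C.nbrs w, C.pay w v + ∑ w ∈ low, (#(C.specials w) : ℝ) ≤
      ∑ w ∈ low, (9 / 2 * (5 - #(C.nbrs w) : ℝ) - 1) := by
    rw [← sum_add_distrib]
    exact sum_le_sum fun w hw => sum_pay_le (mem_filter.1 hw).2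
  have e4 : #paid + #unpaid = #high := card_filter_add_card_filter_not _
  have e5 : #low + #high = Fintype.card V := card_filter_add_card_filter_not _
  have e6 : ∑ w ∈ low, (9 / 2 * (5 - #(C.nbrs w) : ℝ) - 1) =
      9 / 2 * ∑ w ∈ low, (5 - #(C.nbrs w) : ℝ) - #low := by
    rw [sum_sub_distrib, ← mul_sum]; simp
  have e7 : ∑ w ∈ low, (5 - #(C.nbrs w) : ℝ) = ∑ w, (5 - #(C.nbrs w) : ℝ) := by
    rw [← sum_filter_add_sum_filter_not univ (fun v => #(C.nbrs v) < 5) (fun w =>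
      (5 - #(C.nbrs w) : ℝ)), sum_eq_zero (s := univ.filter fun v => ¬ #(C.nbrs v) < 5), add_zero]
    intro w hw
    rw [h5 w hw]; norm_num
  have e8 : ∑ w, (5 - #(C.nbrs w) : ℝ) = 5 * Fintype.card V - ∑ v, (#(C.nbrs v) : ℝ) := by
    rw [sum_sub_distrib]; simp [mul_comm]
  have e4' : (#paid + #unpaid : ℝ) = #high := by exact_mod_cast e4
  have e5' : (#low + #high : ℝ) = Fintype.card V := by exact_mod_cast e5
  rw [e6, e7, e8] at e3
  linarith

/-! ### From the Euclidean plane to the complex plane -/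

/-- The configuration of the points `p v`, moved to the complex plane. -/
noncomputable def ofPlane {V : Type*} (p : V → Plane) (hsep : ∀ u v, u ≠ v → 1 ≤ dist (p u) (p v))
    (hp : InGeneralPosition p) : Config V where
  z v := ⟨p v 0, p v 1⟩
  one_le_norm_sub u v huv := by
    refine (hsep u v huv).trans_eq ?_
    rw [EuclideanSpace.dist_eq, Complex.norm_eq_sqrt_sq_add_sq]
    simp [Real.dist_eq]
  add_ne_two_mul u v w huw h := by
    have h0 := congrArg re h
    have h1 := congrArg im h
    simp at h0 h1
    have key : p w = (2 : ℝ) • (p v - p u) +ᵥ p u := by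
      ext i
      fin_cases i <;> simp <;> linarith
    have hinj : ∀ x y, x ≠ y → p x ≠ p y := by
      intro x y hxy he
      have := hsep x y hxy
      rw [he, dist_self] at this
      linarith
    have huv : u ≠ v := by
      rintro rfl
      apply hinj u w huw
      rw [key]; simp
    have hvw : v ≠ w := by
      rintro rfl
      apply hinj u v huw
      have : (p v - p u) = 0 := by
        have : p v - p u = (2 : ℝ) • (p v - p u) := by
          nth_rw 1 [key]; simp
        rw [two_smul] at this
        simpa using this
      exact (sub_eq_zero.1 this).symm
    apply hp u v w huv huw hvw
    rw [collinear_iff_of_mem (p₀ := p u) (by simp)]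
    refine ⟨p v - p u, ?_⟩
    intro x hx
    simp only [Set.mem_insert_iff, Set.mem_singleton_iff] at hx
    rcases hx with rfl | rfl | rfl
    · exact ⟨0, by simp⟩
    · exact ⟨1, by simp⟩
    · exact ⟨2, key⟩

end Config

end PennyGraph

theorem theorem3 {V : Type*} [Fintype V] (n : ℕ) (hn : Fintype.card V = n)
    (G : SimpleGraph V) (p : V → Plane)
    (hG : IsPennyGraph G p) (hp : InGeneralPosition p) :
    (G.edgeSet.ncard : ℝ) ≤ 43 * (n : ℝ) / 18 ∧
      (0 < n → 43 * (n : ℝ) / 18 < 2.3889 * (n : ℝ)) := by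
  classical
  constructor
  · set C := PennyGraph.Config.ofPlane p hG.one_le_dist hp with hC
    have h1 := C.sum_card_nbrs_le
    have hdeg : ∀ v, G.degree v ≤ (C.nbrs v).card := by
      intro v
      rw [← G.card_neighborFinset_eq_degree]
      apply Finset.card_le_card
      intro w hw
      rw [SimpleGraph.mem_neighborFinset] at hw
      rw [PennyGraph.Config.mem_nbrs, ← hG.dist_eq_one v w hw, dist_comm, EuclideanSpace.dist_eq,
        Complex.norm_eq_sqrt_sq_add_sq]
      simp [PennyGraph.Config.vec, hC, PennyGraph.Config.ofPlane, Real.dist_eq]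
    have h2 : (2 * G.edgeSet.ncard : ℝ) ≤ ∑ v, ((C.nbrs v).card : ℝ) := by
      rw [← SimpleGraph.coe_edgeFinset, Set.ncard_coe_finset]
      have h3 := G.sum_degrees_eq_twice_card_edges
      have h4 : ∑ v, G.degree v ≤ ∑ v, (C.nbrs v).card := Finset.sum_le_sum fun v _ => hdeg v
      rw [h3] at h4
      exact_mod_cast h4
    rw [hn] at h1
    linarith
  · intro h
    have : (0 : ℝ) < n := by exact_mod_cast h
    norm_num
    linarith
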